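/- Let $d\ge 2$ and let $\mu$ be a finite measure on $(0,\infty)$ with positive mass. For $\lambda\ge 0$ let $\xi$ be a Poisson point process on $\mathbb{R}^d\times(0,\infty)$ whose intensity is the product of the Lebesgue measure and $\lambda\mu$, and let $\Sigma(\lambda\mu)=\bigcup_{(c,r)\in\xi}B(c,r)$ be the associated Boolean model, where $B(c,r)$ is the open Euclidean ball with centre $c$ and radius $r$. For $\rho>1$ let $\Sigma^\rho(\lambda\mu)=\bigcup_{n\ge 0}\rho^{-n}\Sigma_n$, where $(\Sigma_n)_{n\ge 0}$ are independent copies of $\Sigma(\lambda\mu)$ (given by independent copies of $\xi$). Let $S(r)$ be the Euclidean sphere of radius $r$ centred at the origin, and for a random set $\Sigma$ let $\{S(r/2)\leftrightarrow S(r)\text{ in }\Sigma\}$ be the event that $\Sigma$ contains a path from $S(r/2)$ to $S(r)$. A random set percolates if, with positive probability, its connected component containing the origin is unbounded (the component is empty if the origin is not in the set). Let $$\widehat{\lambda}_c(\mu)=\sup\{\lambda>0: P(S(r/2)\leftrightarrow S(r)\text{ in }\Sigma(\lambda\mu))\to 0\text{ as }r\to\infty\}\in[0,\infty],$$ with $\sup\emptyset=0$.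 (1) Assume $\int_{[1,\infty)}\beta^d\ln(\beta)\,\mu(d\beta)<\infty$. Then for every $\lambda$ with $0\le\lambda<\widehat{\lambda}_c(\mu)$ there exists $\rho(\lambda)>1$ such that, for all $\rho\ge\rho(\lambda)$, $$P(S(r/2)\leftrightarrow S(r)\text{ in }\Sigma^\rho(\lambda\mu))\to 0\quad\text{as }r\to\infty,$$ and $\Sigma^\rho(\lambda\mu)$ does not percolate. (2) Assume $\int_{[1,\infty)}\beta^d\ln(\beta)\,\mu(d\beta)=\infty$. Then for every $\lambda>0$ and every $\rho>1$, $\Sigma^\rho(\lambda\mu)$ percolates. -/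

import Mathlib

open MeasureTheory ProbabilityTheory Filter Topology
open scoped ENNReal NNReal Pointwise

namespace BooleanModel

noncomputable section

/-- The number of points (possibly infinite) of the random set `ξ` in `A`. -/
def count {Ω E : Type*} (ξ : Ω → Set E) (A : Set E) (ω : Ω) : ℕ∞ :=
  (ξ ω ∩ A).encard

/-- `ξ` is, under `P`, a Poisson point process on `E` with intensity `ν`, seen as a random set of
points: the numbers of points in measurable sets are random variables, the number of points in a
set `A` of finite intensity has the Poisson law with parameter `ν A`, and the numbers of points in
finitely many pairwise disjoint sets are independent. This is meant for σ-finite intensities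
without atoms, for which the process is almost surely simple; the law of the number of points in
a set of infinite intensity then follows. -/
structure IsPoissonProcess {Ω E : Type*} [MeasurableSpace Ω] [MeasurableSpace E]
    (P : Measure Ω) (ξ : Ω → Set E) (ν : Measure E) : Prop where
  measurable_count : ∀ A : Set E, MeasurableSet A → Measurable (count ξ A)
  map_count : ∀ A : Set E, MeasurableSet A → ν A ≠ ∞ →
    P.map (count ξ A) = (poissonMeasure (ν A).toNNReal).map (fun k : ℕ => (k : ℕ∞))
  indep_count : ∀ (n : ℕ) (A : Fin n → Set E), (∀ i, MeasurableSet (A i)) →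
    Pairwise (fun i j => Disjoint (A i) (A j)) → iIndepFun (fun i => count ξ (A i)) P

/-- The σ-algebra on `Ω` generated by the random point set `ξ`, that is by its numbers of points
in measurable sets. -/
@[reducible] def sigmaAlgebra {Ω E : Type*} [MeasurableSpace E] (ξ : Ω → Set E) : MeasurableSpace Ω :=
  ⨆ (A : Set E) (_ : MeasurableSet A), MeasurableSpace.comap (count ξ A) inferInstance

/-- The union of the open Euclidean balls `B(c, r)` over the points `(c, r)` of `s`. -/
def ballUnion {d : ℕ} (s : Set (EuclideanSpace ℝ (Fin d) × ℝ)) : Set (EuclideanSpace ℝ (Fin d)) :=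
  ⋃ x ∈ s, Metric.ball x.1 x.2

/-- The Poisson process `ξ` on `ℝᵈ × ]0, ∞[` that drives the Boolean model `Σ(μ)`: its intensity
is the product of the Lebesgue measure and `μ`. Measures on `]0, ∞[` are seen as measures on `ℝ`
without mass on `]-∞, 0]`. The Boolean model itself is `ω ↦ ballUnion (ξ ω)`. -/
def Drives {d : ℕ} {Ω : Type*} [MeasurableSpace Ω] (P : Measure Ω)
    (ξ : Ω → Set (EuclideanSpace ℝ (Fin d) × ℝ)) (μ : Measure ℝ) : Prop :=
  IsPoissonProcess P ξ ((volume : Measure (EuclideanSpace ℝ (Fin d))).prod μ)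

/-- The sequence `ξ` consists of independent Poisson processes, each of which drives `Σ(μ)`; so
`ω ↦ ballUnion (ξ n ω)`, `n ≥ 0`, are independent copies of `Σ(μ)`. -/
structure DrivesCopies {d : ℕ} {Ω : Type*} [MeasurableSpace Ω] (P : Measure Ω)
    (ξ : ℕ → Ω → Set (EuclideanSpace ℝ (Fin d) × ℝ)) (μ : Measure ℝ) : Prop where
  drives : ∀ n, Drives P (ξ n) μ
  indep : iIndep (fun n => sigmaAlgebra (ξ n)) P

/-- The multiscale set `⋃ₙ ρ⁻ⁿ Σₙ`, where `Σₙ` is the union of the balls of `ξ n`. -/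
def multiscale {d : ℕ} {Ω : Type*} (ρ : ℝ) (ξ : ℕ → Ω → Set (EuclideanSpace ℝ (Fin d) × ℝ))
    (ω : Ω) : Set (EuclideanSpace ℝ (Fin d)) :=
  ⋃ n : ℕ, (ρ ^ n)⁻¹ • ballUnion (ξ n ω)

/-- There is a path in `S` from `A` to `B`. -/
def Connects {X : Type*} [TopologicalSpace X] (S A B : Set X) : Prop :=
  ∃ x ∈ A, ∃ y ∈ B, JoinedIn S x y

/-- The probability that the random set `S` contains a path from the sphere `S(r/2)` to the
sphere `S(r)`, both centred at the origin. -/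
def crossingProb {d : ℕ} {Ω : Type*} [MeasurableSpace Ω] (P : Measure Ω)
    (S : Ω → Set (EuclideanSpace ℝ (Fin d))) (r : ℝ) : ℝ≥0∞ :=
  P {ω | Connects (S ω) (Metric.sphere 0 (r / 2)) (Metric.sphere 0 r)}

/-- The random set `S` percolates: with positive probability its connected component containing
the origin (empty if the origin is not in the set) is unbounded. -/
def Percolates {d : ℕ} {Ω : Type*} [MeasurableSpace Ω] (P : Measure Ω)
    (S : Ω → Set (EuclideanSpace ℝ (Fin d))) : Prop :=
  0 < P {ω | ¬ Bornology.IsBounded (connectedComponentIn (S ω) 0)}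

/-- The crossing probabilities of the Boolean model `Σ(μ)` tend to `0`. They depend only on the
law of the driving Poisson process, so that it does not matter which realization is taken. -/
def CrossingVanishes (d : ℕ) (μ : Measure ℝ) : Prop :=
  ∃ (Ω : Type) (_ : MeasurableSpace Ω) (P : Measure Ω) (_ : IsProbabilityMeasure P)
    (ξ : Ω → Set (EuclideanSpace ℝ (Fin d) × ℝ)),
    Drives P ξ μ ∧ Tendsto (crossingProb P (fun ω => ballUnion (ξ ω))) atTop (𝓝 0)

/-- The critical parameter: the supremum in `[0, ∞]` of all `lam > 0` for which the crossing
probabilities of `Σ(lam μ)` tend to `0` (and `0` if there are none). -/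
def lambdaHat (d : ℕ) (μ : Measure ℝ) : ℝ≥0∞ :=
  ⨆ (lam : ℝ≥0) (_ : 0 < lam ∧ CrossingVanishes d (lam • μ)), (lam : ℝ≥0∞)

/-- The integral of `β ^ d * log β` over `[1, ∞[` with respect to `μ`, in `[0, ∞]`. -/
def logMoment (d : ℕ) (μ : Measure ℝ) : ℝ≥0∞ :=
  ∫⁻ β in Set.Ici (1 : ℝ), ENNReal.ofReal (β ^ d * Real.log β) ∂μ

end

end BooleanModel

/-! Infinite log moment: a ball of scale `n` covers `B(0, R)` once its radius before contraction is
`r ≥ 2Rρ^n` and its centre before contraction has norm at most `r/2`. About `log r / log ρ` scales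
are admissible for a given `r`, so the intensities of such balls, summed over the scales, are at
least of order `∫ r^d log r dμ = ∞`. The scales being independent, almost surely each `B(0, R)` is
covered by a single ball, and the multiscale set is the whole space
(`DrivesCopies.ae_multiscale_eq_univ`).

Finite log moment: let `π(α)` be the supremum over `x` of the probability that the first `N` scales
cross the shell of radii `α/2`, `α` around `x`. Without big balls, a crossing at scale `10α` forces
two crossings at scale `α` in disjoint regions, whence `π(10α) ≤ C π(α)² + T(α)`
(`IsCompletelyRandom.measure_crosses_le`). Here `T(α) → 0` by the log moment, uniformly in `N` and
in `ρ ≥ e`. If `Cε ≤ 1/2`, `T ≤ ε/2` beyond `α₀`, and `π ≤ ε` on `[α₀, 10α₀]`, then `π ≤ ε` beyond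
`α₀` (`le_of_recurrence`) and `π → 0` at a rate depending on neither `N` nor `ρ` (`exists_decay`).

The bound on the initial window is proved by induction on `N`. The first `N + 1` scales are one
Boolean model together with `N` scales contracted by `ρ`. For `ρ` large, the uniform rate makes
crossings of a fixed small size `η` by the contracted part unlikely. Its balls can then be dropped
at the cost of multiplying the other radii by `1 + δ` (`Crosses.enlarge`). By scaling, this amounts
to replacing `λ` by `(1 + δ)^d λ`, still dominated by some `λ'` with vanishing crossing
probabilities. A path being compact, it uses finitely many scales, so the bounds pass to the full
multiscale set.

Only avoidance probabilities are used: they determine the crossing events, and they multiply when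
independent point sets are superposed. -/

set_option linter.unusedSectionVars false

namespace BooleanModel

/-! ### Random sets: avoidance probabilities, independence and stochastic comparison -/

section RandomSets

variable {Ω Ω' E : Type*}

/-- The event that the random set `ζ` does not meet `A`. -/
def avoid (ζ : Ω → Set E) (A : Set E) : Set Ω := {ω | Disjoint (ζ ω) A}

lemma avoid_anti (ζ : Ω → Set E) {A B : Set E} (h : A ⊆ B) : avoid ζ B ⊆ avoid ζ A :=
  fun _ hω => Set.disjoint_of_subset_right h hω

lemma avoid_union (ζ : Ω → Set E) (A B : Set E) : avoid ζ (A ∪ B) = avoid ζ A ∩ avoid ζ B := by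
  ext ω; simp [avoid]

lemma avoid_eq_count (ξ : Ω → Set E) (A : Set E) : avoid ξ A = count ξ A ⁻¹' {0} := by
  ext ω; simp [avoid, count, Set.disjoint_iff_inter_eq_empty]

/-- A random set whose traces on two disjoint sets are independent, in terms of the events of
avoiding a set. -/
structure IsCompletelyRandom [MeasurableSpace Ω] [MeasurableSpace E] (P : Measure Ω)
    (ζ : Ω → Set E) : Prop where
  measurableSet_avoid : ∀ A, MeasurableSet A → MeasurableSet (avoid ζ A)
  measure_avoid_inter : ∀ A B, MeasurableSet A → MeasurableSet B → Disjoint A B →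
    P (avoid ζ A ∩ avoid ζ B) = P (avoid ζ A) * P (avoid ζ B)

variable [MeasurableSpace Ω] [MeasurableSpace Ω'] [MeasurableSpace E]

lemma measurableSet_avoid_sigmaAlgebra (ξ : Ω → Set E) {A : Set E} (hA : MeasurableSet A) :
    MeasurableSet[sigmaAlgebra ξ] (avoid ξ A) := by
  rw [avoid_eq_count]
  have : MeasurableSpace.comap (count ξ A) inferInstance ≤ sigmaAlgebra ξ :=
    le_iSup₂ (f := fun (A : Set E) (_ : MeasurableSet A) =>
      MeasurableSpace.comap (count ξ A) inferInstance) A hA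
  exact this _ ⟨{0}, measurableSet_singleton _, rfl⟩

section Poisson

variable {P : Measure Ω} {ξ : Ω → Set E} {ν : Measure E}

lemma IsPoissonProcess.measurableSet_avoid (h : IsPoissonProcess P ξ ν) {A : Set E}
    (hA : MeasurableSet A) : MeasurableSet (avoid ξ A) := by
  rw [avoid_eq_count]
  exact h.measurable_count A hA (measurableSet_singleton _)

lemma IsPoissonProcess.measure_avoid (h : IsPoissonProcess P ξ ν) {A : Set E}
    (hA : MeasurableSet A) (hν : ν A ≠ ∞) :
    P (avoid ξ A) = ENNReal.ofReal (Real.exp (-(ν A).toReal)) := by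
  have h0 : ((fun k : ℕ => (k : ℕ∞)) ⁻¹' {0}) = {0} := by ext; simp
  rw [avoid_eq_count, ← Measure.map_apply (h.measurable_count A hA) (measurableSet_singleton _),
    h.map_count A hA hν, Measure.map_apply .of_discrete (measurableSet_singleton _), h0,
    poissonMeasure_singleton]
  simp [ENNReal.coe_toNNReal_eq_toReal]

lemma IsPoissonProcess.isCompletelyRandom (h : IsPoissonProcess P ξ ν) :
    IsCompletelyRandom P ξ where
  measurableSet_avoid A hA := h.measurableSet_avoid hA
  measure_avoid_inter A B hA hB hAB := by
    have hi := h.indep_count 2 ![A, B] (by intro i; fin_cases i <;> assumption) (by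
      intro i j hij
      fin_cases i <;> fin_cases j <;> simp_all [hAB.symm])
    have := (hi.indepFun (show (0 : Fin 2) ≠ 1 by decide)).measure_inter_preimage_eq_mul {0} {0}
      (measurableSet_singleton _) (measurableSet_singleton _)
    simpa [avoid_eq_count] using this

lemma ofReal_exp_neg_toReal_le {x : ℝ≥0∞} (hx : x ≠ ∞) :
    ENNReal.ofReal (Real.exp (-x.toReal)) ≤ (1 + x)⁻¹ := by
  have h1 : 1 + x = ENNReal.ofReal (1 + x.toReal) := by
    rw [ENNReal.ofReal_add zero_le_one ENNReal.toReal_nonneg, ENNReal.ofReal_one,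
      ENNReal.ofReal_toReal hx]
  have h2 : 0 < 1 + x.toReal := by positivity
  rw [h1, ← ENNReal.ofReal_inv_of_pos h2, Real.exp_neg]
  refine ENNReal.ofReal_le_ofReal (inv_anti₀ h2 ?_)
  linarith [Real.add_one_le_exp x.toReal]

/-- The law of a count is prescribed only for finite intensity, so `A` is exhausted by its traces on
spanning sets. The bound `(1 + x)⁻¹` is weaker than `exp (-x)`, but it lives in `ℝ≥0∞` and covers `x
= ∞`. -/
lemma IsPoissonProcess.measure_avoid_le [SigmaFinite ν] (h : IsPoissonProcess P ξ ν) {A : Set E}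
    (hA : MeasurableSet A) : P (avoid ξ A) ≤ (1 + ν A)⁻¹ := by
  have hlim : Tendsto (fun n => (1 + ν (A ∩ spanningSets ν n))⁻¹) atTop (𝓝 (1 + ν A)⁻¹) := by
    refine tendsto_inv_iff.2 (tendsto_const_nhds.add ?_)
    · have := tendsto_measure_iUnion_atTop (μ := ν) (s := fun n => A ∩ spanningSets ν n)
        (fun m n hmn => Set.inter_subset_inter_right _ (monotone_spanningSets ν hmn))
      rwa [← Set.inter_iUnion, iUnion_spanningSets, Set.inter_univ] at this
  refine ge_of_tendsto' hlim fun n => ?_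
  have hfin : ν (A ∩ spanningSets ν n) ≠ ∞ :=
    ((measure_mono Set.inter_subset_right).trans_lt (measure_spanningSets_lt_top ν n)).ne
  calc P (avoid ξ A) ≤ P (avoid ξ (A ∩ spanningSets ν n)) :=
        measure_mono (avoid_anti ξ Set.inter_subset_left)
    _ ≤ _ := by
        rw [h.measure_avoid (hA.inter (measurableSet_spanningSets ν n)) hfin]
        exact ofReal_exp_neg_toReal_le hfin

lemma IsPoissonProcess.measure_compl_avoid_le [IsProbabilityMeasure P]
    (h : IsPoissonProcess P ξ ν) {A : Set E} (hA : MeasurableSet A) :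
    P (avoid ξ A)ᶜ ≤ ν A := by
  by_cases hν : ν A = ∞
  · simp [hν]
  rw [prob_compl_eq_one_sub (h.measurableSet_avoid hA), h.measure_avoid hA hν,
    ← ENNReal.ofReal_one, ← ENNReal.ofReal_sub _ (Real.exp_pos _).le]
  refine ENNReal.ofReal_le_of_le_toReal ?_
  linarith [Real.add_one_le_exp (-(ν A).toReal)]

/-- Avoiding a set is less likely for a Poisson process of larger intensity. -/
lemma IsPoissonProcess.measure_avoid_anti {P' : Measure Ω'} {ξ' : Ω' → Set E} {ν' : Measure E}
    [SigmaFinite ν'] (h : IsPoissonProcess P ξ ν) (h' : IsPoissonProcess P' ξ' ν') {A B : Set E}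
    (hA : MeasurableSet A) (hB : MeasurableSet B) (hle : ν A ≤ ν' B) :
    P' (avoid ξ' B) ≤ P (avoid ξ A) := by
  by_cases hν' : ν' B = ∞
  · have := h'.measure_avoid_le hB
    simp only [hν', add_top, ENNReal.inv_top, nonpos_iff_eq_zero] at this
    simp [this]
  rw [h.measure_avoid hA (ne_top_of_le_ne_top hν' hle), h'.measure_avoid hB hν']
  exact ENNReal.ofReal_le_ofReal (Real.exp_le_exp.2 (neg_le_neg (ENNReal.toReal_mono hν' hle)))

end Poisson

section Independence

variable {P : Measure Ω} {ζ : Ω → Set E}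

/-- The σ-algebra generated by the trace of the random set `ζ` on `D`. -/
@[reducible] def avoidAlgebra (ζ : Ω → Set E) (D : Set E) : MeasurableSpace Ω :=
  MeasurableSpace.generateFrom {V | ∃ A, MeasurableSet A ∧ A ⊆ D ∧ V = avoid ζ A}

lemma measurableSet_avoidAlgebra {D A : Set E} (hA : MeasurableSet A) (hAD : A ⊆ D) :
    MeasurableSet[avoidAlgebra ζ D] (avoid ζ A) :=
  MeasurableSpace.measurableSet_generateFrom ⟨A, hA, hAD, rfl⟩

/-- Avoiding `A` and avoiding `B` is avoiding `A ∪ B`, so the generators form π-systems and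
factorization on them suffices. -/
lemma IsCompletelyRandom.indep [IsProbabilityMeasure P] (h : IsCompletelyRandom P ζ)
    {D D' : Set E} (hD : Disjoint D D') : Indep (avoidAlgebra ζ D) (avoidAlgebra ζ D') P := by
  have hle : ∀ D, avoidAlgebra ζ D ≤ ‹MeasurableSpace Ω› := fun D =>
    MeasurableSpace.generateFrom_le (by
      rintro _ ⟨A, hA, -, rfl⟩; exact h.measurableSet_avoid A hA)
  have hpi : ∀ D, IsPiSystem {V | ∃ A, MeasurableSet A ∧ A ⊆ D ∧ V = avoid ζ A} := by
    rintro D _ ⟨A, hA, hAD, rfl⟩ _ ⟨B, hB, hBD, rfl⟩ -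
    exact ⟨A ∪ B, hA.union hB, Set.union_subset hAD hBD, (avoid_union ζ A B).symm⟩
  refine IndepSets.indep (hle D) (hle D') (hpi D) (hpi D') rfl rfl ?_
  rw [IndepSets_iff]
  rintro _ _ ⟨A, hA, hAD, rfl⟩ ⟨B, hB, hBD, rfl⟩
  exact h.measure_avoid_inter A B hA hB (Set.disjoint_of_subset hAD hBD hD)

lemma IsCompletelyRandom.iIndepSet_avoid [IsProbabilityMeasure P] (h : IsCompletelyRandom P ζ)
    {ι : Type*} {B : ι → Set E} (hB : ∀ i, MeasurableSet (B i))
    (hd : Pairwise (fun i j => Disjoint (B i) (B j))) : iIndepSet (fun i => avoid ζ (B i)) P := by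
  classical
  rw [iIndepSet_iff_meas_biInter fun i => h.measurableSet_avoid _ (hB i)]
  intro s
  have key : ∀ s : Finset ι, (⋂ i ∈ s, avoid ζ (B i)) = avoid ζ (⋃ i ∈ s, B i) := by
    intro s; ext ω; simp [avoid]
  induction s using Finset.induction_on with
  | empty => simp
  | insert a s ha ih =>
    rw [Finset.prod_insert ha, ← ih, Finset.set_biInter_insert, key,
      h.measure_avoid_inter _ _ (hB a) (s.measurableSet_biUnion fun i _ => hB i)]
    rw [Set.disjoint_iUnion₂_right]
    exact fun i hi => hd (fun hai => ha (hai ▸ hi))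

end Independence

section Comparison

variable {P : Measure Ω} {P' : Measure Ω'} [IsProbabilityMeasure P] [IsProbabilityMeasure P']
  {ζ : Ω → Set E} {ζ' : Ω' → Set E}

open Classical in
/-- The law of the family of the hitting indicators of disjoint sets, realized by thresholds of
independent uniform variables. -/
lemma IsCompletelyRandom.measure_hits (h : IsCompletelyRandom P ζ) {ι : Type*} [Fintype ι]
    {B : ι → Set E} (hB : ∀ i, MeasurableSet (B i))
    (hd : Pairwise (fun i j => Disjoint (B i) (B j))) (G : Set (ι → Bool)) :
    P {ω | (fun i => decide (ω ∉ avoid ζ (B i))) ∈ G} =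
      (Measure.pi fun _ : ι => (volume.restrict (Set.Icc (0 : ℝ) 1)))
        {u | (fun i => decide ((P (avoid ζ (B i))).toReal < u i)) ∈ G} := by
  have hV : ∀ i, MeasurableSet (avoid ζ (B i)) := fun i => h.measurableSet_avoid _ (hB i)
  set X : ι → Ω → Bool := fun i ω => decide (ω ∉ avoid ζ (B i)) with hX
  have hXm : ∀ i, Measurable (X i) := fun i => measurable_to_bool (by
    have : X i ⁻¹' {true} = (avoid ζ (B i))ᶜ := by ext; simp [hX]
    rw [this]; exact (hV i).compl)
  set Y : ι → ℝ → Bool := fun i u => decide ((P (avoid ζ (B i))).toReal < u) with hY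
  have hYm : ∀ i, Measurable (Y i) := fun i => measurable_to_bool (by
    have : Y i ⁻¹' {true} = Set.Ioi (P (avoid ζ (B i))).toReal := by ext; simp [hY]
    rw [this]; exact measurableSet_Ioi)
  have hU : IsProbabilityMeasure (volume.restrict (Set.Icc (0 : ℝ) 1)) := ⟨by simp⟩
  have hind : iIndepFun X P := by
    have h1 := (h.iIndepSet_avoid hB hd).iIndepFun_indicator (β := ℝ) (m := inferInstance)
    have h2 := h1.comp (fun _ x => decide (x = 0)) (fun _ => measurable_to_bool (by
      have : (fun x : ℝ => decide (x = 0)) ⁻¹' {true} = {0} := by ext; simp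
      rw [this]; exact measurableSet_singleton _))
    convert h2 using 2 with i
    ext ω
    by_cases hω : ω ∈ avoid ζ (B i) <;> simp [hX, hω]
  -- For a uniform `u`, the event `u ≤ p` has probability `p`; with `p` the avoidance probability,
  -- the threshold `p < u` reproduces the law of the hitting indicator.
  have hlaw : ∀ i, P.map (X i) = (volume.restrict (Set.Icc (0 : ℝ) 1)).map (Y i) := by
    intro i
    have hf : P.map (X i) {false} =
        (volume.restrict (Set.Icc (0 : ℝ) 1)).map (Y i) {false} := by
      rw [Measure.map_apply (hXm i) (measurableSet_singleton _),
        Measure.map_apply (hYm i) (measurableSet_singleton _)]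
      have e1 : X i ⁻¹' {false} = avoid ζ (B i) := by ext; simp [hX]
      have e2 : Y i ⁻¹' {false} = Set.Iic (P (avoid ζ (B i))).toReal := by ext; simp [hY]
      rw [e1, e2, Measure.restrict_apply measurableSet_Iic]
      have e3 : Set.Iic (P (avoid ζ (B i))).toReal ∩ Set.Icc 0 1 =
          Set.Icc 0 (P (avoid ζ (B i))).toReal := by
        ext x
        have : (P (avoid ζ (B i))).toReal ≤ 1 := measureReal_le_one
        simp only [Set.mem_inter_iff, Set.mem_Iic, Set.mem_Icc]
        constructor
        · rintro ⟨a, b, c⟩; exact ⟨b, a⟩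
        · rintro ⟨a, b⟩; exact ⟨b, a, b.trans this⟩
      rw [e3, Real.volume_Icc, sub_zero, ENNReal.ofReal_toReal (measure_ne_top _ _)]
    have p1 : IsProbabilityMeasure (P.map (X i)) := Measure.isProbabilityMeasure_map (hXm i).aemeasurable
    have p2 : IsProbabilityMeasure ((volume.restrict (Set.Icc (0 : ℝ) 1)).map (Y i)) :=
      Measure.isProbabilityMeasure_map (hYm i).aemeasurable
    have hc : ({true} : Set Bool) = {false}ᶜ := by ext b; cases b <;> simp
    refine Measure.ext_of_singleton fun b => ?_
    cases b
    · exact hf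
    · rw [hc, prob_compl_eq_one_sub (measurableSet_singleton _),
        prob_compl_eq_one_sub (measurableSet_singleton _), hf]
  have hmap : P.map (fun ω i => X i ω) =
      (Measure.pi fun _ : ι => (volume.restrict (Set.Icc (0 : ℝ) 1))).map
        (fun u i => Y i (u i)) := by
    rw [(iIndepFun_iff_map_fun_eq_pi_map fun i => (hXm i).aemeasurable).1 hind,
      Measure.pi_map_pi fun i => (hYm i).aemeasurable]
    simp_rw [hlaw]
  have hG : MeasurableSet G := G.toFinite.measurableSet
  have hYpi : Measurable (fun (u : ι → ℝ) i => Y i (u i)) :=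
    measurable_pi_lambda _ fun i => (hYm i).comp (measurable_pi_apply i)
  have := congrArg (fun m => m G) hmap
  rwa [Measure.map_apply (measurable_pi_lambda _ hXm) hG, Measure.map_apply hYpi hG] at this

/-- Coupling: both families are driven by the same uniform variables, and the thresholds of `ζ'` are
lower, so it hits every `B i` that `ζ` hits. -/
lemma IsCompletelyRandom.measure_hits_mono (h : IsCompletelyRandom P ζ)
    (h' : IsCompletelyRandom P' ζ')
    (hle : ∀ A, MeasurableSet A → P' (avoid ζ' A) ≤ P (avoid ζ A)) {ι : Type*} [Fintype ι]
    {B : ι → Set E} (hB : ∀ i, MeasurableSet (B i))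
    (hd : Pairwise (fun i j => Disjoint (B i) (B j))) {G : Set (Set ι)} (hG : IsUpperSet G) :
    P {ω | {i | ω ∉ avoid ζ (B i)} ∈ G} ≤ P' {ω | {i | ω ∉ avoid ζ' (B i)} ∈ G} := by
  classical
  have h1 := h.measure_hits hB hd {b | {i | b i = true} ∈ G}
  have h2 := h'.measure_hits hB hd {b | {i | b i = true} ∈ G}
  simp only [Set.mem_ofPred_eq, decide_eq_true_eq] at h1 h2
  rw [h1, h2]
  refine measure_mono fun u hu => hG ?_ hu
  intro i hi
  exact (ENNReal.toReal_mono (measure_ne_top _ _) (hle _ (hB i))).trans_lt hi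

/-- For some `F` in `𝓕`, the set `s` meets all `A q`, `q ∈ F`. -/
def hitSome {Q : Type*} (A : Q → Set E) (𝓕 : Set (Finset Q)) (s : Set E) : Prop :=
  ∃ F ∈ 𝓕, ∀ q ∈ F, ¬ Disjoint s (A q)

lemma setOf_hitSome {Q : Type*} (A : Q → Set E) (𝓕 : Set (Finset Q)) (ζ : Ω → Set E) :
    {ω | hitSome A 𝓕 (ζ ω)} = ⋃ F ∈ 𝓕, ⋂ q ∈ F, (avoid ζ (A q))ᶜ := by
  ext ω; simp [hitSome, avoid]

lemma measurableSet_hitSome {Q : Type*} [Countable Q] {D : Set E} {A : Q → Set E}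
    (hA : ∀ q, MeasurableSet (A q)) (hAD : ∀ q, A q ⊆ D) (𝓕 : Set (Finset Q)) (ζ : Ω → Set E) :
    MeasurableSet[avoidAlgebra ζ D] {ω | hitSome A 𝓕 (ζ ω)} := by
  rw [setOf_hitSome]
  refine MeasurableSet.biUnion 𝓕.to_countable fun F _ => ?_
  exact MeasurableSet.biInter F.countable_toSet fun q _ =>
    (measurableSet_avoidAlgebra (hA q) (hAD q)).compl

/-- Increasing events are more likely for the random set which avoids sets less often. -/
lemma IsCompletelyRandom.measure_hitSome_mono (h : IsCompletelyRandom P ζ)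
    (h' : IsCompletelyRandom P' ζ')
    (hle : ∀ A, MeasurableSet A → P' (avoid ζ' A) ≤ P (avoid ζ A)) {Q : Type*} [Countable Q]
    {A : Q → Set E} (hA : ∀ q, MeasurableSet (A q)) (𝓕 : Set (Finset Q)) :
    P {ω | hitSome A 𝓕 (ζ ω)} ≤ P' {ω | hitSome A 𝓕 (ζ' ω)} := by
  classical
  have hfin : ∀ 𝓖 : Finset (Finset Q),
      P {ω | hitSome A 𝓖 (ζ ω)} ≤ P' {ω | hitSome A 𝓖 (ζ' ω)} := by
    intro 𝓖
    set T : Finset Q := 𝓖.biUnion id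
    -- The sets `A q` may overlap; the atoms of the finite algebra they generate are disjoint, and
    -- hitting `A q` means hitting some atom inside it.
    set B : T.powerset → Set E := fun S => {x | ∀ q ∈ T, x ∈ A q ↔ q ∈ S.1} with hBdef
    have hB : ∀ S, MeasurableSet (B S) := by
      intro S
      have : B S = ⋂ q ∈ T, {x | x ∈ A q ↔ q ∈ S.1} := by ext; simp [hBdef]
      rw [this]
      exact T.measurableSet_biInter fun q _ => (hA q).iff (.const _)
    have hd : Pairwise (fun S S' => Disjoint (B S) (B S')) := by
      intro S S' hne
      rw [Set.disjoint_left]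
      intro x hx hx'
      refine hne (Subtype.ext (Finset.ext fun q => ?_))
      constructor
      · intro hq
        have hT := Finset.mem_powerset.1 S.2 hq
        exact (hx' q hT).1 ((hx q hT).2 hq)
      · intro hq
        have hT := Finset.mem_powerset.1 S'.2 hq
        exact (hx q hT).1 ((hx' q hT).2 hq)
    set G : Set (Set T.powerset) := {R | ∃ F ∈ 𝓖, ∀ q ∈ F, ∃ S ∈ R, q ∈ S.1} with hGdef
    have hG : IsUpperSet G := by
      rintro R R' hR ⟨F, hF, hq⟩
      refine ⟨F, hF, fun q hqF => ?_⟩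
      obtain ⟨S, hS, hqS⟩ := hq q hqF
      exact ⟨S, hR hS, hqS⟩
    have key : ∀ s : Set E, hitSome A 𝓖 s ↔ {S | ¬ Disjoint s (B S)} ∈ G := by
      intro s
      refine exists_congr fun F => and_congr_right fun hF => forall₂_congr fun q hq => ?_
      have hqT : q ∈ T := Finset.mem_biUnion.2 ⟨F, hF, hq⟩
      rw [Set.not_disjoint_iff]
      constructor
      · rintro ⟨x, hxs, hxq⟩
        refine ⟨⟨T.filter fun q => x ∈ A q, Finset.mem_powerset.2 (Finset.filter_subset _ _)⟩,
          Set.not_disjoint_iff.2 ⟨x, hxs, ?_⟩, ?_⟩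
        · intro q' hq'; simp [hq']
        · simp [hqT, hxq]
      · rintro ⟨S, hS, hqS⟩
        obtain ⟨x, hxs, hxB⟩ := Set.not_disjoint_iff.1 hS
        exact ⟨x, hxs, (hxB q hqT).2 hqS⟩
    simp_rw [key]
    exact h.measure_hits_mono h' hle hB hd hG
  have hun : {ω | hitSome A 𝓕 (ζ ω)} =
      ⋃ 𝓖 : {𝓖 : Finset (Finset Q) // (𝓖 : Set (Finset Q)) ⊆ 𝓕}, {ω | hitSome A 𝓖.1 (ζ ω)} := by
    ext ω
    simp only [Set.mem_ofPred_eq, Set.mem_iUnion, hitSome]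
    constructor
    · rintro ⟨F, hF, hq⟩
      exact ⟨⟨{F}, by simpa using hF⟩, F, by simp, hq⟩
    · rintro ⟨𝓖, F, hF, hq⟩
      exact ⟨F, 𝓖.2 hF, hq⟩
  rw [hun, Directed.measure_iUnion]
  · refine iSup_le fun 𝓖 => (hfin 𝓖.1).trans (measure_mono ?_)
    rintro ω ⟨F, hF, hq⟩
    exact ⟨F, 𝓖.2 hF, hq⟩
  · intro 𝓖 𝓖'
    refine ⟨⟨𝓖.1 ∪ 𝓖'.1, by simpa using ⟨𝓖.2, 𝓖'.2⟩⟩, ?_, ?_⟩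
    · rintro ω ⟨F, hF, hq⟩
      exact ⟨F, by simpa using Or.inl hF, hq⟩
    · rintro ω ⟨F, hF, hq⟩
      exact ⟨F, by simpa using Or.inr hF, hq⟩

end Comparison

end RandomSets

/-! ### Crossings of shells and the recurrence between scales `α` and `10 * α` -/

section Crossings

lemma Connects.mono {X : Type*} [TopologicalSpace X] {S T A B : Set X} (h : Connects S A B)
    (hST : S ⊆ T) : Connects T A B := by
  obtain ⟨x, hx, y, hy, hxy⟩ := h
  exact ⟨x, hx, y, hy, hxy.mono hST⟩

/-- A path which starts inside a ball and ends outside a larger concentric one crosses the shell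
between them without leaving the larger ball. -/
lemma connects_of_joinedIn {X : Type*} [PseudoMetricSpace X] {U : Set X} {a b y : X} {s t : ℝ}
    (h : JoinedIn U a b) (ha : dist a y ≤ s) (hst : s ≤ t) (hb : t ≤ dist b y) :
    Connects (U ∩ Metric.closedBall y t) (Metric.sphere y s) (Metric.sphere y t) := by
  obtain ⟨γ, hγ⟩ := h
  set g : ℝ → X := fun r => γ.extend r with hgdef
  have hg : Continuous g := γ.extend.continuous
  have hgU : ∀ r, g r ∈ U := fun r => by
    exact hγ (Set.projIcc 0 1 zero_le_one r)
  have hf : Continuous fun r => dist (g r) y := hg.dist continuous_const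
  have hf0 : dist (g 0) y ≤ s := by simpa [g] using ha
  -- `t₁` is the first time at distance at least `t` from `y`; up to then the path stays in the
  -- closed ball.
  obtain ⟨t₁, ht₁, hleast⟩ : ∃ t₁, IsLeast {r ∈ Set.Icc (0 : ℝ) 1 | t ≤ dist (g r) y} t₁ := by
    refine IsCompact.exists_isLeast ?_ ⟨1, by simp, by simpa [g] using hb⟩
    exact isCompact_Icc.inter_right (isClosed_le continuous_const hf)
  obtain ⟨⟨h0, h1⟩, ht⟩ := ht₁
  have hle : ∀ r ∈ Set.Icc 0 t₁, dist (g r) y ≤ t := by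
    intro r hr
    by_contra hlt
    push Not at hlt
    obtain ⟨r', hr', hr't⟩ := intermediate_value_Icc hr.1 hf.continuousOn
      ⟨hf0.trans hst, hlt.le⟩
    have := hleast ⟨⟨hr'.1, hr'.2.trans (hr.2.trans h1)⟩, hr't.ge⟩
    have hrr : r' = r := le_antisymm hr'.2 (hr.2.trans this)
    simp only [hrr] at hr't
    exact hlt.ne' hr't
  have htt : dist (g t₁) y = t := le_antisymm (hle t₁ ⟨h0, le_rfl⟩) ht
  obtain ⟨r₀, hr₀, hr₀s⟩ := intermediate_value_Icc h0 hf.continuousOn ⟨hf0, hst.trans htt.ge⟩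
  refine ⟨g r₀, hr₀s, g t₁, htt, ?_⟩
  have hpc : IsPathConnected (g '' Set.Icc r₀ t₁) :=
    ((convex_Icc r₀ t₁).isPathConnected ⟨r₀, le_rfl, hr₀.2⟩).image hg
  refine (hpc.joinedIn _ ⟨r₀, ⟨le_rfl, hr₀.2⟩, rfl⟩ _ ⟨t₁, ⟨hr₀.2, le_rfl⟩, rfl⟩).mono ?_
  rintro _ ⟨r, hr, rfl⟩
  exact ⟨hgU r, hle r ⟨hr₀.1.trans hr.1, hr.2⟩⟩

lemma exists_finset_net {X : Type*} [PseudoMetricSpace X] [ProperSpace X] (x : X) (R : ℝ)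
    {m : ℝ} (hm : 0 < m) :
    ∃ Z : Finset X, (∀ z ∈ Z, dist z x ≤ R) ∧ ∀ p, dist p x ≤ R → ∃ z ∈ Z, dist p z ≤ m := by
  obtain ⟨t, hts, htf, ht⟩ := (isCompact_closedBall x R).finite_cover_balls hm
  refine ⟨htf.toFinset, fun z hz => hts (htf.mem_toFinset.1 hz), fun p hp => ?_⟩
  obtain ⟨z, hz, hpz⟩ := Set.mem_iUnion₂.1 (ht hp)
  exact ⟨z, htf.mem_toFinset.2 hz, (Metric.mem_ball.1 hpz).le⟩

variable {d : ℕ}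

lemma mem_ballUnion {s : Set (EuclideanSpace ℝ (Fin d) × ℝ)} {p : EuclideanSpace ℝ (Fin d)} :
    p ∈ ballUnion s ↔ ∃ c r, (c, r) ∈ s ∧ dist p c < r := by
  simp [ballUnion]

lemma isOpen_ballUnion (s : Set (EuclideanSpace ℝ (Fin d) × ℝ)) : IsOpen (ballUnion s) :=
  isOpen_biUnion fun _ _ => Metric.isOpen_ball

lemma ballUnion_mono {s t : Set (EuclideanSpace ℝ (Fin d) × ℝ)} (h : s ⊆ t) :
    ballUnion s ⊆ ballUnion t := Set.biUnion_subset_biUnion_left h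

lemma ballUnion_union (s t : Set (EuclideanSpace ℝ (Fin d) × ℝ)) :
    ballUnion (s ∪ t) = ballUnion s ∪ ballUnion t := Set.biUnion_union _ _ _

/-- The balls containing the `q`-th ball of a countable base. -/
def containing (q : ℕ × ℚ) : Set (EuclideanSpace ℝ (Fin d) × ℝ) :=
  {x | dist x.1 (TopologicalSpace.denseSeq _ q.1) + q.2 ≤ x.2}

lemma measurableSet_containing (q : ℕ × ℚ) :
    MeasurableSet (containing q : Set (EuclideanSpace ℝ (Fin d) × ℝ)) :=
  (isClosed_le (by fun_prop) (by fun_prop)).measurableSet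

/-- The existence of a path in a union of balls is a countable union of finite intersections of
events of the form: some ball contains the `q`-th ball of the base. -/
lemma exists_connects_iff_hitSome (S T : Set (EuclideanSpace ℝ (Fin d))) :
    ∃ 𝓕 : Set (Finset (ℕ × ℚ)), ∀ s : Set (EuclideanSpace ℝ (Fin d) × ℝ),
      Connects (ballUnion s) S T ↔ hitSome containing 𝓕 s := by
  set b : ℕ × ℚ → Set (EuclideanSpace ℝ (Fin d)) := fun q =>
    Metric.ball (TopologicalSpace.denseSeq _ q.1) q.2 with hb
  refine ⟨{F | Connects (⋃ q ∈ F, b q) S T}, fun s => ⟨?_, ?_⟩⟩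
  · rintro ⟨x, hx, y, hy, γ, hγ⟩
    have hcov : Set.range γ ⊆ ⋃ q ∈ {q | ¬ Disjoint s (containing q)}, b q := by
      rintro _ ⟨u, rfl⟩
      obtain ⟨c, r, hs, hr⟩ := mem_ballUnion.1 (hγ u)
      set ε := r - dist (γ u) c with hε
      have hεp : 0 < ε := sub_pos.2 hr
      obtain ⟨n, hn⟩ := (TopologicalSpace.denseRange_denseSeq
        (EuclideanSpace ℝ (Fin d))).exists_dist_lt (γ u) (show 0 < ε / 4 by positivity)
      -- The radius exceeds `ε / 4`, so the base ball contains `γ u`, and is below `ε / 2`, so that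
      -- it stays inside `B(c, r)`, where `γ u` has margin `ε`.
      obtain ⟨q, hq1, hq2⟩ := exists_rat_btwn (show ε / 4 < ε / 2 by linarith)
      refine Set.mem_iUnion₂.2 ⟨(n, q), Set.not_disjoint_iff.2 ⟨(c, r), hs, ?_⟩, ?_⟩
      · change dist c (TopologicalSpace.denseSeq _ n) + (q : ℝ) ≤ r
        have := dist_triangle_left c (TopologicalSpace.denseSeq _ n) (γ u)
        linarith
      · exact Metric.mem_ball.2 (hn.trans hq1)
    obtain ⟨F, hFs, hFf, hF⟩ := (isCompact_range γ.continuous).elim_finite_subcover_image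
      (fun q _ => Metric.isOpen_ball) hcov
    refine ⟨hFf.toFinset, ⟨x, hx, y, hy, γ, fun u => ?_⟩, fun q hq => hFs (hFf.mem_toFinset.1 hq)⟩
    simpa [hb] using hF ⟨u, rfl⟩
  · rintro ⟨F, hF, hq⟩
    refine Connects.mono hF (Set.iUnion₂_subset fun q hqF p hp => ?_)
    obtain ⟨⟨c, r⟩, hs, hc⟩ := Set.not_disjoint_iff.1 (hq q hqF)
    refine mem_ballUnion.2 ⟨c, r, hs, ?_⟩
    change dist c (TopologicalSpace.denseSeq _ q.1) + (q.2 : ℝ) ≤ r at hc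
    have := Metric.mem_ball.1 hp
    have := dist_triangle_right p c (TopologicalSpace.denseSeq _ q.1)
    linarith

/-- By compactness a path is covered by finitely many base balls, each contained in a ball of some
`s n`; the largest of these indices serves. -/
lemma exists_connects_ballUnion {s : ℕ → Set (EuclideanSpace ℝ (Fin d) × ℝ)} (hs : Monotone s)
    {S T : Set (EuclideanSpace ℝ (Fin d))} (h : Connects (ballUnion (⋃ n, s n)) S T) :
    ∃ n, Connects (ballUnion (s n)) S T := by
  obtain ⟨𝓕, h𝓕⟩ := exists_connects_iff_hitSome S T
  simp_rw [h𝓕] at h ⊢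
  obtain ⟨F, hF, hq⟩ := h
  have : ∀ q, ∃ n, q ∈ F → ¬ Disjoint (s n) (containing q) := by
    intro q
    by_cases hqF : q ∈ F
    · have := hq q hqF
      rw [Set.disjoint_iUnion_left] at this
      push Not at this
      exact this.imp fun n hn _ => hn
    · exact ⟨0, fun h => absurd h hqF⟩
  choose n hn using this
  refine ⟨F.sup n, F, hF, fun q hqF hd => hn q hqF ?_⟩
  exact Set.disjoint_of_subset_left (hs (Finset.le_sup hqF)) hd

/-- There is a path in the union of the balls of `s` between the spheres of radii `α / 2` and `α`
centred at `x`. -/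
def Crosses (x : EuclideanSpace ℝ (Fin d)) (α : ℝ)
    (s : Set (EuclideanSpace ℝ (Fin d) × ℝ)) : Prop :=
  Connects (ballUnion s) (Metric.sphere x (α / 2)) (Metric.sphere x α)

lemma Crosses.mono {x : EuclideanSpace ℝ (Fin d)} {α : ℝ}
    {s t : Set (EuclideanSpace ℝ (Fin d) × ℝ)} (h : Crosses x α s) (hst : s ⊆ t) :
    Crosses x α t := Connects.mono h (ballUnion_mono hst)

/-- The balls with centre at distance less than `2 * α` from `y`. -/
def near (y : EuclideanSpace ℝ (Fin d)) (α : ℝ) : Set (EuclideanSpace ℝ (Fin d) × ℝ) :=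
  Metric.ball y (2 * α) ×ˢ Set.univ

lemma measurableSet_near (y : EuclideanSpace ℝ (Fin d)) (α : ℝ) : MeasurableSet (near y α) :=
  measurableSet_ball.prod .univ

/-- A set containing all the balls of radius at least `α` which may influence the crossing of the
shell of scale `10 * α` around `x`. -/
def bigBalls (x : EuclideanSpace ℝ (Fin d)) (α : ℝ) : Set (EuclideanSpace ℝ (Fin d) × ℝ) :=
  {b | α ≤ b.2 ∧ dist b.1 x ≤ 12 * b.2}

lemma measurableSet_bigBalls (x : EuclideanSpace ℝ (Fin d)) (α : ℝ) :
    MeasurableSet (bigBalls x α) :=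
  (measurableSet_le measurable_const measurable_snd).inter
    (measurableSet_le (f := fun b : EuclideanSpace ℝ (Fin d) × ℝ => dist b.1 x)
      (g := fun b => 12 * b.2) (by fun_prop) (by fun_prop))

/-- Without big balls, a crossing at scale `10 * α` entails two distant crossings at scale `α`. -/
lemma Crosses.exists_near {x : EuclideanSpace ℝ (Fin d)} {α : ℝ} (hα : 0 < α)
    {Z : Finset (EuclideanSpace ℝ (Fin d))} (hZ : ∀ z ∈ Z, dist z 0 ≤ 10)
    (hnet : ∀ p, dist p (0 : EuclideanSpace ℝ (Fin d)) ≤ 10 → ∃ z ∈ Z, dist p z ≤ 1 / 2)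
    {s : Set (EuclideanSpace ℝ (Fin d) × ℝ)} (hbig : Disjoint s (bigBalls x α))
    (h : Crosses x (10 * α) s) :
    ∃ z ∈ Z, ∃ z' ∈ Z, 4 ≤ dist z z' ∧ Crosses (x + α • z) α (s ∩ near (x + α • z) α) ∧
      Crosses (x + α • z') α (s ∩ near (x + α • z') α) := by
  have key : ∀ a b, JoinedIn (ballUnion s) a b → dist a x ≤ 10 * α → 5 * α ≤ dist a b →
      ∃ z ∈ Z, dist a (x + α • z) ≤ α / 2 ∧
        Crosses (x + α • z) α (s ∩ near (x + α • z) α) := by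
    intro a b hab ha hd
    obtain ⟨z, hz, hpz⟩ := hnet (α⁻¹ • (a - x)) (by
      rw [dist_zero_right, norm_smul, Real.norm_of_nonneg (by positivity), ← dist_eq_norm,
        inv_mul_le_iff₀ hα]
      linarith)
    have hay : dist a (x + α • z) ≤ α / 2 := by
      have : a - (x + α • z) = α • (α⁻¹ • (a - x) - z) := by
        rw [smul_sub, smul_inv_smul₀ hα.ne']; abel
      rw [dist_eq_norm, this, norm_smul, Real.norm_of_nonneg hα.le, ← dist_eq_norm]
      nlinarith
    refine ⟨z, hz, hay, ?_⟩
    have hby : α ≤ dist b (x + α • z) := by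
      have := dist_triangle_right a b (x + α • z)
      linarith
    refine (connects_of_joinedIn hab hay (by linarith) hby).mono ?_
    rintro p ⟨hp, hpy⟩
    obtain ⟨c, r, hs, hr⟩ := mem_ballUnion.1 hp
    have hzx : dist (x + α • z) x ≤ 10 * α := by
      rw [dist_eq_norm, add_sub_cancel_left, norm_smul, Real.norm_of_nonneg hα.le,
        ← dist_zero_right, mul_comm]
      exact mul_le_mul_of_nonneg_right (hZ z hz) hα.le
    have hpy' := Metric.mem_closedBall.1 hpy
    have hcy : dist c (x + α • z) < r + α := by
      have := dist_triangle_left c (x + α • z) p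
      linarith
    have hrα : r < α := by
      -- If `α ≤ r`, the centre would be within `r + α + 10 * α ≤ 12 * r` of `x`, making the ball a
      -- big one. This is the origin of the constant in `bigBalls`.
      by_contra hle
      push Not at hle
      refine Set.disjoint_left.1 hbig hs ⟨hle, ?_⟩
      have := dist_triangle c (x + α • z) x
      simp only
      linarith
    refine mem_ballUnion.2 ⟨c, r, ⟨hs, ?_, trivial⟩, hr⟩
    exact Metric.mem_ball.2 (by simp only; linarith)
  obtain ⟨a, ha, b, hb, hab⟩ := h
  rw [Metric.mem_sphere] at ha hb
  have h5 : 5 * α ≤ dist a b := by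
    have := dist_triangle_left b x a
    linarith
  obtain ⟨z, hz, hza, hcz⟩ := key a b hab (by linarith) h5
  obtain ⟨z', hz', hzb, hcz'⟩ := key b a hab.symm hb.le (by rwa [dist_comm])
  -- The ends of the crossing are at least `5 * α` apart, and each is within `α / 2` of its net
  -- point, which leaves `4 * α`: just enough for two balls of radius `2 * α` to be disjoint.
  refine ⟨z, hz, z', hz', ?_, hcz, hcz'⟩
  have h1 : dist (x + α • z) (x + α • z') = α * dist z z' := by
    rw [dist_add_left, dist_smul₀, Real.norm_of_nonneg hα.le]
  have h2 : dist a b ≤ dist a (x + α • z) + α * dist z z' + dist b (x + α • z') := by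
    rw [← h1, dist_comm b]
    exact dist_triangle4 _ _ _ _
  nlinarith

/-- The probability of a crossing at scale `10 * α` is controlled by the square of that at scale
`α` and by the probability that there is a big ball. -/
lemma IsCompletelyRandom.measure_crosses_le {Ω : Type*} [MeasurableSpace Ω] {P : Measure Ω}
    [IsProbabilityMeasure P] {ζ : Ω → Set (EuclideanSpace ℝ (Fin d) × ℝ)}
    (h : IsCompletelyRandom P ζ)
    {Z : Finset (EuclideanSpace ℝ (Fin d))} (hZ : ∀ z ∈ Z, dist z 0 ≤ 10)
    (hnet : ∀ p, dist p (0 : EuclideanSpace ℝ (Fin d)) ≤ 10 → ∃ z ∈ Z, dist p z ≤ 1 / 2)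
    {α : ℝ} (hα : 0 < α) {p : ℝ≥0∞} (hp : ∀ y, P {ω | Crosses y α (ζ ω)} ≤ p)
    (x : EuclideanSpace ℝ (Fin d)) :
    P {ω | Crosses x (10 * α) (ζ ω)} ≤
      (Z.card : ℝ≥0∞) ^ 2 * p ^ 2 + P (avoid ζ (bigBalls x α))ᶜ := by
  set N : EuclideanSpace ℝ (Fin d) → Set Ω := fun z =>
    {ω | Crosses (x + α • z) α (ζ ω ∩ near (x + α • z) α)} with hN
  set I := (Z ×ˢ Z).filter fun z => 4 ≤ dist z.1 z.2
  have hNp : ∀ z, P (N z) ≤ p := fun z =>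
    (measure_mono fun ω hω => Crosses.mono hω Set.inter_subset_left).trans (hp _)
  have hNm : ∀ z, MeasurableSet[avoidAlgebra ζ (near (x + α • z) α)] (N z) := by
    intro z
    obtain ⟨𝓕, h𝓕⟩ := exists_connects_iff_hitSome
      (Metric.sphere (x + α • z) (α / 2)) (Metric.sphere (x + α • z) α)
    have : N z = {ω | hitSome (fun q => containing q ∩ near (x + α • z) α) 𝓕 (ζ ω)} := by
      ext ω
      simp only [hN, Set.mem_ofPred_eq, Crosses, h𝓕, hitSome]
      refine exists_congr fun F => and_congr_right fun _ => forall₂_congr fun q _ => ?_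
      rw [Set.disjoint_iff_inter_eq_empty, Set.disjoint_iff_inter_eq_empty,
        Set.inter_right_comm, Set.inter_assoc]
    rw [this]
    exact measurableSet_hitSome
      (fun q => (measurableSet_containing q).inter (measurableSet_near _ _))
      (fun q => Set.inter_subset_right) 𝓕 ζ
  have hpair : ∀ z ∈ I, P (N z.1 ∩ N z.2) ≤ p ^ 2 := by
    rintro ⟨z, z'⟩ hz
    have hdist : 4 ≤ dist z z' := (Finset.mem_filter.1 hz).2
    have hdisj : Disjoint (near (x + α • z) α) (near (x + α • z') α) := by
      refine Set.Disjoint.set_prod_left (Metric.ball_disjoint_ball ?_) _ _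
      rw [dist_add_left, dist_smul₀, Real.norm_of_nonneg hα.le]
      nlinarith
    rw [(Indep_iff _ _ P).1 (h.indep hdisj) _ _ (hNm z) (hNm z'), sq]
    exact mul_le_mul' (hNp z) (hNp z')
  have hsub : {ω | Crosses x (10 * α) (ζ ω)} ⊆
      (⋃ z ∈ I, N z.1 ∩ N z.2) ∪ (avoid ζ (bigBalls x α))ᶜ := by
    intro ω hω
    by_cases hb : ω ∈ avoid ζ (bigBalls x α)
    · obtain ⟨z, hz, z', hz', hd, h1, h2⟩ := Crosses.exists_near hα hZ hnet hb hω
      refine Or.inl (Set.mem_iUnion₂.2 ⟨(z, z'), ?_, h1, h2⟩)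
      exact Finset.mem_filter.2 ⟨Finset.mem_product.2 ⟨hz, hz'⟩, hd⟩
    · exact Or.inr hb
  refine (measure_mono hsub).trans ((measure_union_le _ _).trans (add_le_add_left ?_ _))
  calc P (⋃ z ∈ I, N z.1 ∩ N z.2) ≤ ∑ z ∈ I, P (N z.1 ∩ N z.2) := measure_biUnion_finset_le _ _
    _ ≤ I.card • p ^ 2 := Finset.sum_le_card_nsmul _ _ _ hpair
    _ ≤ _ := by
      rw [nsmul_eq_mul]
      gcongr
      calc (I.card : ℝ≥0∞) ≤ ((Z ×ˢ Z).card : ℕ) := by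
            exact_mod_cast Finset.card_filter_le _ _
        _ = _ := by rw [Finset.card_product]; push_cast; ring

end Crossings

/-! ### Contraction and superposition of the scales -/

section Superposition

lemma avoid_image {Ω E F : Type*} (f : E → F) (ζ : Ω → Set E) (A : Set F) :
    avoid (fun ω => f '' ζ ω) A = avoid ζ (f ⁻¹' A) := by
  ext ω; simp [avoid, Set.disjoint_image_left]

/-- Since only avoidance is recorded, points with the same image do no harm and `f` need not be
injective. -/
lemma IsCompletelyRandom.image {Ω E F : Type*} [MeasurableSpace Ω] [MeasurableSpace E]
    [MeasurableSpace F] {P : Measure Ω} {ζ : Ω → Set E} (h : IsCompletelyRandom P ζ)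
    {f : E → F} (hf : Measurable f) : IsCompletelyRandom P (fun ω => f '' ζ ω) where
  measurableSet_avoid A hA := by
    rw [avoid_image]; exact h.measurableSet_avoid _ (hf hA)
  measure_avoid_inter A B hA hB hAB := by
    simp_rw [avoid_image]
    exact h.measure_avoid_inter _ _ (hf hA) (hf hB) (hAB.preimage f)

variable {d : ℕ}

/-- The contraction of ratio `t⁻¹`, acting on balls. -/
noncomputable def shrink (t : ℝ) (b : EuclideanSpace ℝ (Fin d) × ℝ) : EuclideanSpace ℝ (Fin d) × ℝ :=
  (t⁻¹ • b.1, t⁻¹ * b.2)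

lemma measurable_shrink (t : ℝ) :
    Measurable (shrink t : EuclideanSpace ℝ (Fin d) × ℝ → EuclideanSpace ℝ (Fin d) × ℝ) := by
  unfold shrink; fun_prop

lemma shrink_mul (t u : ℝ) (b : EuclideanSpace ℝ (Fin d) × ℝ) :
    shrink (t * u) b = shrink t (shrink u b) := by
  simp [shrink, smul_smul, mul_comm, mul_left_comm]

lemma ballUnion_image_shrink {t : ℝ} (ht : 0 < t) (s : Set (EuclideanSpace ℝ (Fin d) × ℝ)) :
    ballUnion (shrink t '' s) = t⁻¹ • ballUnion s := by
  have ht' : 0 < t⁻¹ := inv_pos.2 ht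
  simp only [ballUnion, Set.biUnion_image, Set.smul_set_iUnion₂, shrink]
  refine Set.iUnion₂_congr fun b _ => ?_
  rw [smul_ball ht'.ne', Real.norm_of_nonneg ht'.le]

/-- The balls of the first `N` scales of the multiscale model. -/
noncomputable def scales {Ω : Type*} (ρ : ℝ) (ξ : ℕ → Ω → Set (EuclideanSpace ℝ (Fin d) × ℝ)) (N : ℕ) (ω : Ω) :
    Set (EuclideanSpace ℝ (Fin d) × ℝ) :=
  ⋃ n ∈ Finset.range N, shrink (ρ ^ n) '' ξ n ω

lemma scales_mono {Ω : Type*} (ρ : ℝ) (ξ : ℕ → Ω → Set (EuclideanSpace ℝ (Fin d) × ℝ)) (ω : Ω) :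
    Monotone fun N => scales ρ ξ N ω := fun _ _ h =>
  Set.biUnion_subset_biUnion_left (fun _ hn => Finset.range_mono h hn)

lemma scales_succ {Ω : Type*} (ρ : ℝ) (ξ : ℕ → Ω → Set (EuclideanSpace ℝ (Fin d) × ℝ)) (N : ℕ)
    (ω : Ω) : scales ρ ξ (N + 1) ω =
      ξ 0 ω ∪ shrink ρ '' scales ρ (fun n => ξ (n + 1)) N ω := by
  ext b
  simp only [scales, Set.mem_iUnion, Finset.mem_range, Set.mem_union, Set.mem_image, exists_prop]
  constructor
  · rintro ⟨n, hn, a, ha, rfl⟩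
    cases n with
    | zero => left; simpa [shrink] using ha
    | succ n =>
      right
      exact ⟨shrink (ρ ^ n) a, ⟨n, by omega, a, ha, rfl⟩, by rw [pow_succ', shrink_mul]⟩
  · rintro (hb | ⟨_, ⟨n, hn, a, ha, rfl⟩, rfl⟩)
    · exact ⟨0, by omega, b, hb, by simp [shrink]⟩
    · exact ⟨n + 1, by omega, a, ha, by rw [pow_succ', shrink_mul]⟩

lemma multiscale_eq {Ω : Type*} {ρ : ℝ} (hρ : 0 < ρ)
    (ξ : ℕ → Ω → Set (EuclideanSpace ℝ (Fin d) × ℝ)) (ω : Ω) :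
    multiscale ρ ξ ω = ballUnion (⋃ N, scales ρ ξ N ω) := by
  have h1 : (⋃ N, scales ρ ξ N ω) = ⋃ n, shrink (ρ ^ n) '' ξ n ω := by
    ext b
    simp only [scales, Set.mem_iUnion, Finset.mem_range, exists_prop]
    exact ⟨fun ⟨_, n, _, h⟩ => ⟨n, h⟩, fun ⟨n, h⟩ => ⟨n + 1, n, by omega, h⟩⟩
  have h2 : ∀ s : ℕ → Set (EuclideanSpace ℝ (Fin d) × ℝ),
      ballUnion (⋃ n, s n) = ⋃ n, ballUnion (s n) := fun s => Set.biUnion_iUnion _ _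
  rw [h1, h2, multiscale]
  exact Set.iUnion_congr fun n => (ballUnion_image_shrink (pow_pos hρ n) _).symm

lemma avoid_scales {Ω : Type*} (ρ : ℝ) (ξ : ℕ → Ω → Set (EuclideanSpace ℝ (Fin d) × ℝ)) (N : ℕ)
    (A : Set (EuclideanSpace ℝ (Fin d) × ℝ)) :
    avoid (scales ρ ξ N) A = ⋂ n ∈ Finset.range N, avoid (ξ n) (shrink (ρ ^ n) ⁻¹' A) := by
  ext ω; simp [avoid, scales, Set.disjoint_image_left]

variable {Ω : Type*} [MeasurableSpace Ω] {P : Measure Ω}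
  {ξ : ℕ → Ω → Set (EuclideanSpace ℝ (Fin d) × ℝ)} {μ : Measure ℝ}

lemma DrivesCopies.shift (h : DrivesCopies P ξ μ) : DrivesCopies P (fun n => ξ (n + 1)) μ where
  drives n := h.drives (n + 1)
  indep := iIndep.precomp (m := fun n => sigmaAlgebra (ξ n)) (add_left_injective 1) h.indep

lemma DrivesCopies.measure_avoid_scales (h : DrivesCopies P ξ μ) (ρ : ℝ) (N : ℕ)
    {A : Set (EuclideanSpace ℝ (Fin d) × ℝ)} (hA : MeasurableSet A) :
    P (avoid (scales ρ ξ N) A) =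
      ∏ n ∈ Finset.range N, P (avoid (ξ n) (shrink (ρ ^ n) ⁻¹' A)) := by
  rw [avoid_scales]
  exact h.indep.meas_biInter fun n _ =>
    measurableSet_avoid_sigmaAlgebra (ξ n) (measurable_shrink _ hA)

lemma DrivesCopies.isCompletelyRandom_scales (h : DrivesCopies P ξ μ) (ρ : ℝ) (N : ℕ) :
    IsCompletelyRandom P (scales ρ ξ N) where
  measurableSet_avoid A hA := by
    rw [avoid_scales]
    exact (Finset.range N).measurableSet_biInter fun n _ =>
      (h.drives n).measurableSet_avoid (measurable_shrink _ hA)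
  measure_avoid_inter A B hA hB hAB := by
    rw [← avoid_union, h.measure_avoid_scales ρ N (hA.union hB), h.measure_avoid_scales ρ N hA,
      h.measure_avoid_scales ρ N hB, ← Finset.prod_mul_distrib]
    refine Finset.prod_congr rfl fun n _ => ?_
    rw [Set.preimage_union, avoid_union]
    exact (h.drives n).isCompletelyRandom.measure_avoid_inter _ _ (measurable_shrink _ hA)
      (measurable_shrink _ hB) (hAB.preimage _)

lemma DrivesCopies.measure_compl_avoid_scales_le [IsProbabilityMeasure P]
    (h : DrivesCopies P ξ μ) (ρ : ℝ) (N : ℕ)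
    {A : Set (EuclideanSpace ℝ (Fin d) × ℝ)} (hA : MeasurableSet A) :
    P (avoid (scales ρ ξ N) A)ᶜ ≤ ∑ n ∈ Finset.range N,
      ((volume : Measure (EuclideanSpace ℝ (Fin d))).prod μ) (shrink (ρ ^ n) ⁻¹' A) := by
  have : (avoid (scales ρ ξ N) A)ᶜ =
      ⋃ n ∈ Finset.range N, (avoid (ξ n) (shrink (ρ ^ n) ⁻¹' A))ᶜ := by
    rw [avoid_scales]; simp only [Set.compl_iInter]
  rw [this]
  refine (measure_biUnion_finset_le _ _).trans (Finset.sum_le_sum fun n _ => ?_)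
  exact (h.drives n).measure_compl_avoid_le (measurable_shrink _ hA)

/-- From `(1 + a) * (1 + b) ≥ 1 + a + b`. It turns a divergent sum of intensities into a vanishing
avoidance probability. -/
lemma prod_inv_one_add_le (a : ℕ → ℝ≥0∞) (N : ℕ) :
    ∏ n ∈ Finset.range N, (1 + a n)⁻¹ ≤ (1 + ∑ n ∈ Finset.range N, a n)⁻¹ := by
  induction N with
  | zero => simp
  | succ N ih =>
    rw [Finset.prod_range_succ, Finset.sum_range_succ]
    calc _ ≤ (1 + ∑ n ∈ Finset.range N, a n)⁻¹ * (1 + a N)⁻¹ := by gcongr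
      _ = ((1 + ∑ n ∈ Finset.range N, a n) * (1 + a N))⁻¹ := by
        rw [ENNReal.mul_inv] <;> simp
      _ ≤ _ := by
        refine ENNReal.inv_le_inv.2 ?_
        rw [mul_add, mul_one, add_mul, one_mul, ← add_assoc, ← add_assoc]
        exact add_le_add_left le_self_add _ |>.trans (by rw [add_right_comm])

end Superposition

/-! ### Infinite log moment: the whole space is covered -/

section Covering

variable {d : ℕ}

/-- The balls containing the ball of radius `R` centred at the origin. -/
def coverBall (R : ℝ) : Set (EuclideanSpace ℝ (Fin d) × ℝ) := {b | dist b.1 0 + R ≤ b.2}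

lemma measurableSet_coverBall (R : ℝ) :
    MeasurableSet (coverBall R : Set (EuclideanSpace ℝ (Fin d) × ℝ)) :=
  measurableSet_le (f := fun b : EuclideanSpace ℝ (Fin d) × ℝ => dist b.1 0 + R)
    (g := fun b => b.2) (by fun_prop) (by fun_prop)

lemma ball_subset_ballUnion {s : Set (EuclideanSpace ℝ (Fin d) × ℝ)} {R : ℝ}
    (h : ¬ Disjoint s (coverBall R)) : Metric.ball 0 R ⊆ ballUnion s := by
  obtain ⟨⟨c, r⟩, hs, hc⟩ := Set.not_disjoint_iff.1 h
  intro p hp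
  have hc' : dist c 0 + R ≤ r := hc
  have := Metric.mem_ball.1 hp
  have := dist_triangle_right p c 0
  exact mem_ballUnion.2 ⟨c, r, hs, by linarith⟩

lemma volume_closedBall_eq (c : EuclideanSpace ℝ (Fin d)) {r : ℝ} (hr : 0 ≤ r) :
    volume (Metric.closedBall c r) =
      ENNReal.ofReal (r ^ d) * volume (Metric.ball (0 : EuclideanSpace ℝ (Fin d)) 1) := by
  rw [Measure.addHaar_closedBall _ _ hr, finrank_euclideanSpace_fin]

/-- When `r ≥ 2 * R * t`, every centre of norm at most `r / 2` is suitable, because `r / 2 + R * t ≤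
r`. -/
lemma le_prod_coverBall {μ : Measure ℝ} [SFinite μ] {R t : ℝ} (hR : 0 < R) (ht : 0 < t) :
    ∫⁻ r in Set.Ici (2 * R * t), ENNReal.ofReal ((r / 2) ^ d) *
        volume (Metric.ball (0 : EuclideanSpace ℝ (Fin d)) 1) ∂μ ≤
      ((volume : Measure (EuclideanSpace ℝ (Fin d))).prod μ) (shrink t ⁻¹' coverBall R) := by
  rw [Measure.prod_apply_symm (measurable_shrink t (measurableSet_coverBall R)),
    ← lintegral_indicator measurableSet_Ici]
  refine lintegral_mono fun r => ?_
  by_cases hr : r ∈ Set.Ici (2 * R * t)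
  · rw [Set.indicator_of_mem hr]
    have hr' : 2 * R * t ≤ r := hr
    have hr0 : 0 ≤ r / 2 := by have : 0 < 2 * R * t := by positivity
                               linarith
    rw [← volume_closedBall_eq 0 hr0]
    refine measure_mono fun c hc => ?_
    have hc' : ‖c‖ ≤ r / 2 := by simpa using hc
    change dist (t⁻¹ • c) 0 + R ≤ t⁻¹ * r
    rw [dist_zero_right, norm_smul, Real.norm_of_nonneg (by positivity)]
    have : t⁻¹ * (‖c‖ + R * t) ≤ t⁻¹ * r :=
      mul_le_mul_of_nonneg_left (by linarith) (by positivity)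
    calc t⁻¹ * ‖c‖ + R = t⁻¹ * (‖c‖ + R * t) := by field_simp
      _ ≤ _ := this
  · rw [Set.indicator_of_notMem hr]; exact zero_le

lemma lintegral_log_tail_eq_top {μ : Measure ℝ} [IsFiniteMeasure μ] (h : logMoment d μ = ∞)
    {b : ℝ} (hb : 1 ≤ b) :
    ∫⁻ r in Set.Ici b, ENNReal.ofReal (r ^ d * Real.log r) ∂μ = ∞ := by
  by_contra hfin
  have hsub : Set.Ici (1 : ℝ) = Set.Ico 1 b ∪ Set.Ici b := (Set.Ico_union_Ici_eq_Ici hb).symm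
  have h1 : ∫⁻ r in Set.Ico 1 b, ENNReal.ofReal (r ^ d * Real.log r) ∂μ < ∞ := by
    calc _ ≤ ∫⁻ r in Set.Ico 1 b, ENNReal.ofReal (b ^ d * Real.log b) ∂μ := by
          refine setLIntegral_mono measurable_const fun r hr => ENNReal.ofReal_le_ofReal ?_
          have := hr.1
          have := hr.2.le
          have := Real.log_nonneg hr.1
          gcongr
      _ < ∞ := by
          rw [setLIntegral_const]
          exact ENNReal.mul_lt_top ENNReal.ofReal_lt_top (measure_lt_top _ _)
  have h2 := lintegral_union_le (μ := μ)
    (fun r => ENNReal.ofReal (r ^ d * Real.log r)) (Set.Ico 1 b) (Set.Ici b)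
  rw [← hsub] at h2
  exact (h2.trans_lt (ENNReal.add_lt_top.2 ⟨h1, Ne.lt_top hfin⟩)).ne h

/-- The condition on `r` says `log (2 * R) ≤ log r / 2`; the other half of `log r` leaves room for
every `n ≤ log r / (2 * log ρ)`. -/
lemma tsum_indicator_ge {R ρ r : ℝ} (hR : 1 ≤ R) (hρ : 1 < ρ) (hr : (2 * R) ^ 2 ≤ r) :
    ENNReal.ofReal (Real.log r / (2 * Real.log ρ)) ≤
      ∑' n : ℕ, (Set.Ici (2 * R * ρ ^ n)).indicator (fun _ => (1 : ℝ≥0∞)) r := by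
  have hlρ : 0 < Real.log ρ := Real.log_pos hρ
  have hr0 : 0 < r := lt_of_lt_of_le (by positivity) hr
  set x := Real.log r / (2 * Real.log ρ) with hx
  have hlog : 2 * Real.log (2 * R) ≤ Real.log r := by
    have := Real.log_le_log (by positivity) hr
    rwa [Real.log_pow, Nat.cast_ofNat] at this
  have hlogR : 0 ≤ Real.log (2 * R) := Real.log_nonneg (by linarith)
  have hx0 : 0 ≤ x := div_nonneg (by linarith) (by positivity)
  have hxl : x * Real.log ρ = Real.log r / 2 := by rw [hx]; field_simp
  have hmem : ∀ n ∈ Finset.range (⌊x⌋₊ + 1), r ∈ Set.Ici (2 * R * ρ ^ n) := by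
    intro n hn
    have hn' : (n : ℝ) ≤ x :=
      (Nat.le_floor_iff hx0).1 (Nat.lt_succ_iff.1 (Finset.mem_range.1 hn))
    change 2 * R * ρ ^ n ≤ r
    rw [← Real.log_le_log_iff (by positivity) hr0, Real.log_mul (by positivity) (by positivity),
      Real.log_pow]
    nlinarith
  calc ENNReal.ofReal x ≤ ((⌊x⌋₊ + 1 : ℕ) : ℝ≥0∞) := by
        rw [← ENNReal.ofReal_natCast]
        exact ENNReal.ofReal_le_ofReal (by push_cast; exact (Nat.lt_floor_add_one x).le)
    _ = ∑ n ∈ Finset.range (⌊x⌋₊ + 1),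
          (Set.Ici (2 * R * ρ ^ n)).indicator (fun _ => (1 : ℝ≥0∞)) r := by
        rw [Finset.sum_congr rfl fun n hn => Set.indicator_of_mem (hmem n hn) _]
        simp
    _ ≤ _ := ENNReal.sum_le_tsum _

lemma tsum_prod_coverBall_eq_top {μ : Measure ℝ} [IsFiniteMeasure μ] (h : logMoment d μ = ∞)
    {lam : ℝ≥0} (hlam : 0 < lam) {R ρ : ℝ} (hR : 1 ≤ R) (hρ : 1 < ρ) :
    ∑' n : ℕ, ((volume : Measure (EuclideanSpace ℝ (Fin d))).prod (lam • μ))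
      (shrink (ρ ^ n) ⁻¹' coverBall R) = ∞ := by
  set v := volume (Metric.ball (0 : EuclideanSpace ℝ (Fin d)) 1) with hv
  have hv0 : v ≠ 0 := (Metric.measure_ball_pos _ _ one_pos).ne'
  have hlρ : 0 < Real.log ρ := Real.log_pos hρ
  rw [eq_top_iff]
  calc (∞ : ℝ≥0∞)
      = lam * (ENNReal.ofReal ((2 ^ d * (2 * Real.log ρ))⁻¹) * v *
          ∫⁻ r in Set.Ici ((2 * R) ^ 2), ENNReal.ofReal (r ^ d * Real.log r) ∂μ) := by
        rw [lintegral_log_tail_eq_top h (by nlinarith), ENNReal.mul_top, ENNReal.mul_top]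
        · exact_mod_cast hlam.ne'
        · refine mul_ne_zero ?_ hv0
          rw [Ne, ENNReal.ofReal_eq_zero, not_le]
          positivity
    _ ≤ lam * ∫⁻ r, ∑' n : ℕ, (Set.Ici (2 * R * ρ ^ n)).indicator
          (fun r => ENNReal.ofReal ((r / 2) ^ d) * v) r ∂μ := by
        gcongr
        rw [← lintegral_const_mul _ (by fun_prop), ← lintegral_indicator measurableSet_Ici]
        refine lintegral_mono fun r => ?_
        by_cases hr : r ∈ Set.Ici ((2 * R) ^ 2)
        · have hr0 : 0 ≤ r := le_trans (by positivity) (Set.mem_Ici.1 hr)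
          have hi : ∀ n : ℕ, (Set.Ici (2 * R * ρ ^ n)).indicator
              (fun r => ENNReal.ofReal ((r / 2) ^ d) * v) r =
              ENNReal.ofReal ((r / 2) ^ d) * v *
                (Set.Ici (2 * R * ρ ^ n)).indicator (fun _ => (1 : ℝ≥0∞)) r := by
            intro n
            by_cases hn : r ∈ Set.Ici (2 * R * ρ ^ n) <;> simp [hn]
          simp_rw [hi]
          rw [Set.indicator_of_mem hr, ENNReal.tsum_mul_left]
          calc _ = ENNReal.ofReal ((r / 2) ^ d) * v *
                ENNReal.ofReal (Real.log r / (2 * Real.log ρ)) := by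
                rw [mul_right_comm, mul_right_comm (ENNReal.ofReal ((r / 2) ^ d)),
                  ← ENNReal.ofReal_mul (by positivity), ← ENNReal.ofReal_mul (by positivity)]
                congr 2
                rw [div_pow]; field_simp
            _ ≤ _ := by gcongr; exact tsum_indicator_ge hR hρ hr
        · rw [Set.indicator_of_notMem hr]; exact zero_le
    _ = ∑' n : ℕ, ∫⁻ r in Set.Ici (2 * R * ρ ^ n), ENNReal.ofReal ((r / 2) ^ d) * v
          ∂(lam • μ) := by
        rw [lintegral_tsum fun n => (Measurable.indicator (by fun_prop)
          measurableSet_Ici).aemeasurable, ← ENNReal.tsum_mul_left]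
        refine tsum_congr fun n => ?_
        rw [Measure.restrict_smul, lintegral_smul_measure, lintegral_indicator measurableSet_Ici]
        rfl
    _ ≤ _ := ENNReal.tsum_le_tsum fun n => le_prod_coverBall (by linarith) (by positivity)

/-- For each integer `R`, independence bounds the probability that no scale has a ball containing
`B(0, R + 1)` by the inverse of a divergent partial sum. -/
lemma DrivesCopies.ae_multiscale_eq_univ {Ω : Type*} [MeasurableSpace Ω] {P : Measure Ω}
    {ξ : ℕ → Ω → Set (EuclideanSpace ℝ (Fin d) × ℝ)} {μ : Measure ℝ} [IsFiniteMeasure μ]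
    (hμ : logMoment d μ = ∞) {lam : ℝ≥0} (hlam : 0 < lam) {ρ : ℝ} (hρ : 1 < ρ)
    (h : DrivesCopies P ξ (lam • μ)) : ∀ᵐ ω ∂P, multiscale ρ ξ ω = Set.univ := by
  set ν := (volume : Measure (EuclideanSpace ℝ (Fin d))).prod (lam • μ)
  have hnull : ∀ R : ℕ, P {ω | ∀ N, ω ∈ avoid (scales ρ ξ N) (coverBall (R + 1))} = 0 := by
    intro R
    have hA := measurableSet_coverBall (d := d) (R + 1)
    have hle : ∀ N, P {ω | ∀ N, ω ∈ avoid (scales ρ ξ N) (coverBall (R + 1))} ≤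
        (1 + ∑ n ∈ Finset.range N, ν (shrink (ρ ^ n) ⁻¹' coverBall (R + 1)))⁻¹ := by
      intro N
      calc _ ≤ P (avoid (scales ρ ξ N) (coverBall (R + 1))) :=
          measure_mono (Set.ofPred_subset.2 fun ω hω => hω N)
        _ = _ := h.measure_avoid_scales ρ N hA
        _ ≤ ∏ n ∈ Finset.range N, (1 + ν (shrink (ρ ^ n) ⁻¹' coverBall (R + 1)))⁻¹ :=
          Finset.prod_le_prod' fun n _ => (h.drives n).measure_avoid_le (measurable_shrink _ hA)
        _ ≤ _ := prod_inv_one_add_le _ N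
    have hlim : Tendsto (fun N =>
        (1 + ∑ n ∈ Finset.range N, ν (shrink (ρ ^ n) ⁻¹' coverBall (R + 1)))⁻¹) atTop (𝓝 0) := by
      rw [← ENNReal.inv_top, tendsto_inv_iff]
      have := ENNReal.tendsto_nat_tsum fun n => ν (shrink (ρ ^ n) ⁻¹' coverBall (R + 1))
      rw [tsum_prod_coverBall_eq_top hμ hlam (by simp) hρ] at this
      simpa using tendsto_const_nhds (x := (1 : ℝ≥0∞)).add this
    exact le_antisymm (ge_of_tendsto' hlim hle) zero_le
  have hae : ∀ᵐ ω ∂P, ∀ R : ℕ, ∃ N, ω ∉ avoid (scales ρ ξ N) (coverBall (R + 1)) := by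
    refine ae_all_iff.2 fun R => ?_
    rw [ae_iff]
    simpa using hnull R
  filter_upwards [hae] with ω hω
  refine Set.eq_univ_of_forall fun p => ?_
  obtain ⟨R, hR⟩ := exists_nat_ge (dist p 0)
  obtain ⟨N, hN⟩ := hω R
  rw [multiscale_eq (by linarith)]
  exact ballUnion_mono (Set.subset_iUnion _ N)
    (ball_subset_ballUnion hN (Metric.mem_ball.2 (by linarith)))

lemma DrivesCopies.percolates {Ω : Type*} [MeasurableSpace Ω] {P : Measure Ω}
    [IsProbabilityMeasure P] (hd : 1 ≤ d)
    {ξ : ℕ → Ω → Set (EuclideanSpace ℝ (Fin d) × ℝ)} {μ : Measure ℝ} [IsFiniteMeasure μ]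
    (hμ : logMoment d μ = ∞) {lam : ℝ≥0} (hlam : 0 < lam) {ρ : ℝ} (hρ : 1 < ρ)
    (h : DrivesCopies P ξ (lam • μ)) : Percolates P (multiscale ρ ξ) := by
  have hne : Nonempty (Fin d) := ⟨⟨0, hd⟩⟩
  have hae : ∀ᵐ ω ∂P, ω ∈
      {ω | ¬ Bornology.IsBounded (connectedComponentIn (multiscale ρ ξ ω) 0)} := by
    filter_upwards [h.ae_multiscale_eq_univ hμ hlam hρ] with ω hω
    rw [hω, connectedComponentIn_univ, PreconnectedSpace.connectedComponent_eq_univ]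
    exact NormedSpace.unbounded_univ ℝ (EuclideanSpace ℝ (Fin d))
  have h0 : P {ω | ¬ Bornology.IsBounded (connectedComponentIn (multiscale ρ ξ ω) 0)}ᶜ = 0 := hae
  by_contra hp
  -- No measurability of the event is needed: if its outer measure vanished, it and its null
  -- complement would cover a space of mass one.
  have hz : P {ω | ¬ Bornology.IsBounded (connectedComponentIn (multiscale ρ ξ ω) 0)} = 0 := by
    simpa [Percolates] using hp
  have := measure_union_null hz h0
  rw [Set.union_compl_self, measure_univ] at this
  exact one_ne_zero this

end Covering

/-! ### Finite log moment: big balls are rare, uniformly in the number of scales -/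

section Tails

variable {d : ℕ}

/-- The condition on the centre is scale invariant: undoing the contraction gives a ball of radius
`12 * r` whatever `t`. Only the lower bound on the radius depends on `t`. -/
lemma prod_bigBalls_le {μ : Measure ℝ} [SFinite μ] {t α : ℝ} (ht : 0 < t) (hα : 0 < α)
    (x : EuclideanSpace ℝ (Fin d)) :
    ((volume : Measure (EuclideanSpace ℝ (Fin d))).prod μ) (shrink t ⁻¹' bigBalls x α) ≤
      ∫⁻ r, (Set.Ici (α * t)).indicator (fun _ => (1 : ℝ≥0∞)) r *
        (ENNReal.ofReal ((12 * r) ^ d) *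
          volume (Metric.ball (0 : EuclideanSpace ℝ (Fin d)) 1)) ∂μ := by
  rw [Measure.prod_apply_symm (measurable_shrink t (measurableSet_bigBalls x α))]
  refine lintegral_mono fun r => ?_
  by_cases hr : α * t ≤ r
  · have hr0 : 0 ≤ 12 * r := by have : 0 < α * t := by positivity
                                linarith
    rw [Set.indicator_of_mem (Set.mem_Ici.2 hr), one_mul, ← volume_closedBall_eq (t • x) hr0]
    refine measure_mono fun c hc => ?_
    have hc' : dist (t⁻¹ • c) x ≤ 12 * (t⁻¹ * r) := hc.2
    have : dist c (t • x) = t * dist (t⁻¹ • c) x := by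
      conv_lhs => rw [← smul_inv_smul₀ ht.ne' c]
      rw [dist_smul₀, Real.norm_of_nonneg ht.le]
    rw [Metric.mem_closedBall, this]
    calc t * dist (t⁻¹ • c) x ≤ t * (12 * (t⁻¹ * r)) := by gcongr
      _ = 12 * r := by field_simp
  · have : (fun c : EuclideanSpace ℝ (Fin d) => (c, r)) ⁻¹' (shrink t ⁻¹' bigBalls x α) = ∅ := by
      refine Set.eq_empty_of_forall_notMem fun c hc => hr ?_
      have hc' : α ≤ t⁻¹ * r := hc.1
      rwa [le_inv_mul_iff₀ ht, mul_comm] at hc'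
    rw [this, measure_empty]; exact zero_le

/-- As `α` and `ρ` are at least `e`, `α * ρ ^ n ≤ r` forces `n + 1 ≤ log r`. At most `⌊log r⌋`
scales count, whatever `ρ` and `N`; this is how the logarithm enters the moment condition. -/
lemma sum_indicator_le {ρ α r : ℝ} (hρ : Real.exp 1 ≤ ρ) (hα : Real.exp 1 ≤ α) (N : ℕ) :
    ∑ n ∈ Finset.range N, (Set.Ici (α * ρ ^ n)).indicator (fun _ => (1 : ℝ≥0∞)) r ≤
      (Set.Ici α).indicator (fun r => ENNReal.ofReal (Real.log r)) r := by
  have hα0 : 0 < α := (Real.exp_pos 1).trans_le hα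
  have hρ1 : 1 ≤ ρ := (Real.one_le_exp zero_le_one).trans hρ
  by_cases hr : α ≤ r
  · rw [Set.indicator_of_mem (Set.mem_Ici.2 hr)]
    have hr0 : 0 < r := hα0.trans_le hr
    have hlog : 1 ≤ Real.log r := (Real.le_log_iff_exp_le hr0).2 (hα.trans hr)
    calc _ ≤ ∑ n ∈ Finset.range N, if n ∈ Finset.range ⌊Real.log r⌋₊ then (1 : ℝ≥0∞) else 0 := by
          refine Finset.sum_le_sum fun n _ => ?_
          by_cases hn : α * ρ ^ n ≤ r
          · rw [Set.indicator_of_mem (Set.mem_Ici.2 hn), if_pos]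
            rw [Finset.mem_range, ← Nat.succ_le_iff, Nat.le_floor_iff (by linarith),
              Real.le_log_iff_exp_le hr0]
            refine le_trans ?_ hn
            push_cast
            rw [Real.exp_add, mul_comm, ← mul_one (n : ℝ), Real.exp_nat_mul]
            gcongr
          · rw [Set.indicator_of_notMem (by simpa using hn)]; exact zero_le
      _ ≤ (⌊Real.log r⌋₊ : ℝ≥0∞) := by
          rw [Finset.sum_ite_mem, Finset.sum_const, nsmul_one]
          exact_mod_cast (Finset.card_le_card Finset.inter_subset_right).trans
            (Finset.card_range _).le
      _ ≤ _ := by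
          rw [← ENNReal.ofReal_natCast]
          exact ENNReal.ofReal_le_ofReal (Nat.floor_le (by linarith))
  · refine (Finset.sum_eq_zero fun n _ => Set.indicator_of_notMem (fun hn => hr ?_) _).trans_le
      zero_le
    exact (le_mul_of_one_le_right hα0.le (one_le_pow₀ hρ1)).trans hn

/-- A bound for the intensity of the balls of radius at least `α`, of any scale, which are close
to a given point in comparison with their radius. -/
noncomputable def tailBound (d : ℕ) (μ : Measure ℝ) (lam : ℝ≥0) (α : ℝ) : ℝ≥0∞ :=
  lam * (ENNReal.ofReal (12 ^ d) * volume (Metric.ball (0 : EuclideanSpace ℝ (Fin d)) 1)) *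
    ∫⁻ r in Set.Ici α, ENNReal.ofReal (r ^ d * Real.log r) ∂μ

lemma sum_prod_bigBalls_le {μ : Measure ℝ} [SFinite μ] (lam : ℝ≥0) {ρ α : ℝ}
    (hρ : Real.exp 1 ≤ ρ) (hα : Real.exp 1 ≤ α) (x : EuclideanSpace ℝ (Fin d)) (N : ℕ) :
    ∑ n ∈ Finset.range N, ((volume : Measure (EuclideanSpace ℝ (Fin d))).prod (lam • μ))
      (shrink (ρ ^ n) ⁻¹' bigBalls x α) ≤ tailBound d μ lam α := by
  have hα0 : 0 < α := (Real.exp_pos 1).trans_le hα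
  have hρ0 : 0 < ρ := (Real.exp_pos 1).trans_le hρ
  set v := volume (Metric.ball (0 : EuclideanSpace ℝ (Fin d)) 1) with hv
  calc _ ≤ ∑ n ∈ Finset.range N, ∫⁻ r, (Set.Ici (α * ρ ^ n)).indicator (fun _ => (1 : ℝ≥0∞)) r *
        (ENNReal.ofReal ((12 * r) ^ d) * v) ∂(lam • μ) :=
        Finset.sum_le_sum fun n _ => prod_bigBalls_le (pow_pos hρ0 n) hα0 x
    _ = lam * ∫⁻ r, (∑ n ∈ Finset.range N,
          (Set.Ici (α * ρ ^ n)).indicator (fun _ => (1 : ℝ≥0∞)) r) *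
        (ENNReal.ofReal ((12 * r) ^ d) * v) ∂μ := by
        simp_rw [Finset.sum_mul]
        rw [← lintegral_finsetSum, lintegral_smul_measure]
        · rfl
        · exact fun n _ => (measurable_const.indicator measurableSet_Ici).mul (by fun_prop)
    _ ≤ lam * ∫⁻ r, (Set.Ici α).indicator (fun r => (ENNReal.ofReal (12 ^ d) * v) *
          ENNReal.ofReal (r ^ d * Real.log r)) r ∂μ := by
        gcongr with r
        refine (mul_le_mul_left (sum_indicator_le hρ hα N) _).trans ?_
        by_cases hr : α ≤ r
        · have hr0 : 0 ≤ r := hα0.le.trans hr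
          rw [Set.indicator_of_mem (Set.mem_Ici.2 hr), Set.indicator_of_mem (Set.mem_Ici.2 hr),
            mul_pow, ENNReal.ofReal_mul (by positivity), ENNReal.ofReal_mul (by positivity)]
          exact le_of_eq (by ring)
        · rw [Set.indicator_of_notMem (by simpa using hr), zero_mul]; exact zero_le
    _ = _ := by
        rw [lintegral_indicator measurableSet_Ici, lintegral_const_mul _ (by fun_prop), tailBound,
          ← hv]
        ring

lemma tendsto_tailBound {μ : Measure ℝ} (h : logMoment d μ < ∞) (lam : ℝ≥0) :
    Tendsto (tailBound d μ lam) atTop (𝓝 0) := by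
  set f : ℝ → ℝ≥0∞ := fun r => ENNReal.ofReal (r ^ d * Real.log r)
  set m := (μ.restrict (Set.Ici 1)).withDensity f
  have hm : ∀ α, m (Set.Ici α) = ∫⁻ r in Set.Ici α ∩ Set.Ici 1, f r ∂μ := fun α => by
    rw [withDensity_apply _ measurableSet_Ici, Measure.restrict_restrict measurableSet_Ici]
  have hlim : Tendsto (fun α : ℝ => m (Set.Ici α)) atTop (𝓝 0) := by
    have h0 : m (⋂ α : ℝ, Set.Ici α) = 0 := by
      have : (⋂ α : ℝ, Set.Ici α) = ∅ := Set.eq_empty_of_forall_notMem fun r hr =>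
        absurd (Set.mem_iInter.1 hr (r + 1)) (by simp)
      rw [this, measure_empty]
    rw [← h0]
    refine tendsto_measure_iInter_atTop (fun α => measurableSet_Ici.nullMeasurableSet)
      (fun a b hab => Set.Ici_subset_Ici.2 hab) ⟨1, ?_⟩
    rw [hm, Set.inter_self]
    exact h.ne
  have hlim' : Tendsto (fun α : ℝ => ∫⁻ r in Set.Ici α, f r ∂μ) atTop (𝓝 0) := by
    refine hlim.congr' ?_
    filter_upwards [eventually_ge_atTop 1] with α hα
    rw [hm, Set.inter_eq_left.2 (Set.Ici_subset_Ici.2 hα)]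
  have hK : (lam * (ENNReal.ofReal (12 ^ d) *
      volume (Metric.ball (0 : EuclideanSpace ℝ (Fin d)) 1)) : ℝ≥0∞) ≠ ∞ :=
    ENNReal.mul_ne_top ENNReal.coe_ne_top
      (ENNReal.mul_ne_top ENNReal.ofReal_ne_top measure_ball_lt_top.ne)
  have := ENNReal.Tendsto.const_mul hlim' (Or.inr hK)
  rwa [mul_zero] at this

end Tails

/-! ### The recurrence inequality -/

section Decay

/-- The bound `ε` reproduces itself, since `C * ε ^ 2 + ε / 2 ≤ ε`, and the window `[α₀, 10 * α₀]`
reaches every larger scale by multiplication by `10`. -/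
lemma le_of_recurrence {f T : ℝ → ℝ≥0∞} {C ε : ℝ≥0∞} {α₀ : ℝ} (hα₀ : 0 < α₀)
    (hf : ∀ α, α₀ ≤ α → f (10 * α) ≤ C * f α ^ 2 + T α) (hC : C * ε ≤ 2⁻¹)
    (hT : ∀ α, α₀ ≤ α → T α ≤ ε / 2) (hbase : ∀ α, α₀ ≤ α → α ≤ 10 * α₀ → f α ≤ ε) :
    ∀ α, α₀ ≤ α → f α ≤ ε := by
  have key : ∀ n : ℕ, ∀ α, α₀ ≤ α → α ≤ 10 ^ (n + 1) * α₀ → f α ≤ ε := by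
    intro n
    induction n with
    | zero => simpa using hbase
    | succ n ih =>
      intro α h1 h2
      by_cases h3 : α ≤ 10 * α₀
      · exact hbase α h1 h3
      have h4 : α₀ ≤ α / 10 := by push Not at h3; linarith
      have h5 : α / 10 ≤ 10 ^ (n + 1) * α₀ := by rw [pow_succ] at h2; linarith
      have h6 := hf _ h4
      rw [mul_div_cancel₀ α (by norm_num : (10 : ℝ) ≠ 0)] at h6
      have h7 := ih _ h4 h5
      calc f α ≤ C * f (α / 10) ^ 2 + T (α / 10) := h6
        _ ≤ C * ε ^ 2 + ε / 2 := by gcongr; exact hT _ h4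
        _ = C * ε * ε + ε / 2 := by ring
        _ ≤ 2⁻¹ * ε + ε / 2 := by gcongr
        _ = ε := by rw [mul_comm, ← div_eq_mul_inv, ENNReal.add_halves]
  intro α hα
  obtain ⟨n, hn⟩ := pow_unbounded_of_one_lt (α / α₀) (by norm_num : (1 : ℝ) < 10)
  refine key n α hα ?_
  rw [div_lt_iff₀ hα₀] at hn
  refine hn.le.trans ?_
  gcongr
  · norm_num
  · omega

/-- A function subject to the recurrence inequality decays, at a rate which does not depend on
the function. -/
lemma exists_decay {T : ℝ → ℝ≥0∞} {C ε : ℝ≥0∞} {α₀ : ℝ} (hα₀ : 0 < α₀) (hC : C * ε ≤ 2⁻¹)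
    (hε : ε ≠ ∞) (hT : Tendsto T atTop (𝓝 0)) {η : ℝ≥0∞} (hη : 0 < η) :
    ∃ A, ∀ f : ℝ → ℝ≥0∞, (∀ α, α₀ ≤ α → f (10 * α) ≤ C * f α ^ 2 + T α) →
      (∀ α, α₀ ≤ α → f α ≤ ε) → ∀ α, A ≤ α → f α ≤ η := by
  obtain ⟨A₀, hA₀⟩ := eventually_atTop.1
    (ENNReal.tendsto_nhds_zero.1 hT (η / 2 / 2) (by simpa using hη.ne'))
  set A₁ := max A₀ α₀
  have hA₁ : α₀ ≤ A₁ := le_max_right _ _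
  have hpow : Tendsto (fun j : ℕ => ε * 2⁻¹ ^ j) atTop (𝓝 0) := by
    have := ENNReal.Tendsto.const_mul (a := ε)
      (ENNReal.tendsto_pow_atTop_nhds_zero_of_lt_one (r := 2⁻¹) (by simp)) (Or.inr hε)
    simpa using this
  obtain ⟨j, hj⟩ := (ENNReal.tendsto_nhds_zero.1 hpow (η / 2) (by simpa using hη.ne')).exists
  refine ⟨10 ^ j * A₁, fun f hf hfε => ?_⟩
  -- One factor of `C * f ^ 2` is bounded by `ε`, making the recurrence a contraction of ratio
  -- `1/2`; the value `η / 2` is stable when the error is at most `η / 4`.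
  have key : ∀ j : ℕ, ∀ α, 10 ^ j * A₁ ≤ α → f α ≤ ε * 2⁻¹ ^ j + η / 2 := by
    intro j
    induction j with
    | zero =>
      intro α hα
      simpa using (hfε α (hA₁.trans (by simpa using hα))).trans le_self_add
    | succ j ih =>
      intro α hα
      have h5 : 10 ^ j * A₁ ≤ α / 10 := by rw [pow_succ] at hα; linarith
      have h4 : A₁ ≤ α / 10 := le_trans
        (le_mul_of_one_le_left (hα₀.le.trans hA₁) (one_le_pow₀ (by norm_num))) h5
      have h6 := hf _ (hA₁.trans h4)
      rw [mul_div_cancel₀ α (by norm_num : (10 : ℝ) ≠ 0)] at h6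
      have h7 := ih _ h5
      calc f α ≤ C * f (α / 10) ^ 2 + T (α / 10) := h6
        _ = C * f (α / 10) * f (α / 10) + T (α / 10) := by ring
        _ ≤ C * ε * (ε * 2⁻¹ ^ j + η / 2) + η / 2 / 2 := by
          gcongr
          · exact hfε _ (hA₁.trans h4)
          · exact hA₀ _ ((le_max_left _ _).trans h4)
        _ ≤ 2⁻¹ * (ε * 2⁻¹ ^ j + η / 2) + η / 2 / 2 := by gcongr
        _ = ε * 2⁻¹ ^ (j + 1) + (η / 2 / 2 + η / 2 / 2) := by
          rw [pow_succ, ENNReal.div_eq_inv_mul (a := η / 2)]; ring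
        _ = _ := by rw [ENNReal.add_halves]
  intro α hα
  calc f α ≤ ε * 2⁻¹ ^ j + η / 2 := key j α hα
    _ ≤ η / 2 + η / 2 := by gcongr
    _ = η := ENNReal.add_halves η

end Decay

/-! ### Removing the small scales by enlarging the balls of the first one -/

section FirstScale

variable {d : ℕ}

lemma Crosses.image_similarity {φ : EuclideanSpace ℝ (Fin d) → EuclideanSpace ℝ (Fin d)} {k : ℝ}
    (hk : 0 < k) (hφ : ∀ p q, dist (φ p) (φ q) = k * dist p q) {x : EuclideanSpace ℝ (Fin d)}
    {α : ℝ} {s : Set (EuclideanSpace ℝ (Fin d) × ℝ)} (h : Crosses x α s) :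
    Crosses (φ x) (k * α) ((fun b => (φ b.1, k * b.2)) '' s) := by
  have hc : Continuous φ :=
    (LipschitzWith.of_dist_le_mul (K := ⟨k, hk.le⟩) fun p q => (hφ p q).le).continuous
  obtain ⟨a, ha, b, hb, hab⟩ := h
  refine ⟨φ a, ?_, φ b, ?_, (hab.map hc).mono ?_⟩
  · rw [Metric.mem_sphere] at ha ⊢; rw [hφ, ha]; ring
  · rw [Metric.mem_sphere] at hb ⊢; rw [hφ, hb]
  · rintro _ ⟨p, hp, rfl⟩
    obtain ⟨c, r, hs, hr⟩ := mem_ballUnion.1 hp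
    refine mem_ballUnion.2 ⟨φ c, k * r, ⟨(c, r), hs, rfl⟩, ?_⟩
    rw [hφ]
    gcongr

lemma Crosses.of_shrink {ρ : ℝ} (hρ : 0 < ρ) {y : EuclideanSpace ℝ (Fin d)} {η : ℝ}
    {s : Set (EuclideanSpace ℝ (Fin d) × ℝ)} (h : Crosses y η (shrink ρ '' s)) :
    Crosses (ρ • y) (ρ * η) s := by
  have := h.image_similarity (φ := fun p => ρ • p) hρ fun p q => by
    rw [dist_smul₀, Real.norm_of_nonneg hρ.le]
  rw [Set.image_image] at this
  simpa [shrink, smul_inv_smul₀ hρ.ne', mul_inv_cancel_left₀ hρ.ne'] using this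

/-- If the balls of `w` only form small clusters, and if the balls of `s` are not too small, then
a crossing in the union is a crossing by the slightly enlarged balls of `s`. -/
lemma Crosses.enlarge {x : EuclideanSpace ℝ (Fin d)} {α η δ r₀ L : ℝ}
    {s w : Set (EuclideanSpace ℝ (Fin d) × ℝ)} (hη : 0 < η) (hδ : 0 < δ) (hηδ : 2 * η ≤ δ * r₀)
    (hr₀ : r₀ ≤ 1) (hηα : 4 * η ≤ α) (hαL : α ≤ L) {Z : Finset (EuclideanSpace ℝ (Fin d))}
    (hnet : ∀ p, dist p (0 : EuclideanSpace ℝ (Fin d)) ≤ L → ∃ z ∈ Z, dist p z ≤ η / 2)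
    (hw : ∀ z ∈ Z, ¬ Crosses (x + z) η w)
    (hs : Disjoint s (Metric.closedBall x (L + 1) ×ˢ Set.Iio r₀))
    (h : Crosses x α (s ∪ w)) :
    Crosses x α ((fun b => (b.1, (1 + δ) * b.2)) '' s) := by
  obtain ⟨a₀, ha₀, b₀, hb₀, hab₀⟩ := h
  obtain ⟨a, ha, b, hb, γ, hγ⟩ := connects_of_joinedIn hab₀ (Metric.mem_sphere.1 ha₀).le
    (by linarith) (Metric.mem_sphere.1 hb₀).ge
  refine ⟨a, ha, b, hb, γ, fun u => ?_⟩
  rw [Metric.mem_sphere] at ha hb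
  set p := γ u with hp
  have hK : IsPathConnected (Set.range γ) := by
    rw [← γ.image_extend_of_subset subset_rfl]
    exact ((convex_Icc (0 : ℝ) 1).isPathConnected ⟨0, by simp⟩).image γ.extend.continuous
  have hpx : dist p x ≤ α := (hγ u).2
  obtain ⟨z, hz, hpz⟩ := hnet (p - x) (by
    rw [dist_zero_right, ← dist_eq_norm]; exact hpx.trans hαL)
  have hpy : dist p (x + z) ≤ η / 2 := by
    rw [dist_eq_norm] at hpz ⊢
    rwa [← sub_sub]
  -- The ends of the crossing are at least `α / 2 ≥ 2 * η` apart, so they cannot both be within less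
  -- than `η` of `x + z`.
  have hend : ∃ e ∈ Set.range γ, η ≤ dist e (x + z) := by
    by_contra hcon
    push Not at hcon
    have h1 := hcon a ⟨0, γ.source⟩
    have h2 := hcon b ⟨1, γ.target⟩
    have h3 := dist_triangle_right a b (x + z)
    have h4 := dist_triangle_left b x a
    linarith
  obtain ⟨e, he, hey⟩ := hend
  -- Otherwise the piece of path from `p` to `e` would cross the shell of scale `η` around `x + z`
  -- inside the balls of `w` alone.
  have hnear : ∃ q ∈ Set.range γ, dist q (x + z) ≤ η ∧ q ∈ ballUnion s := by
    by_contra hcon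
    push Not at hcon
    refine hw z hz ((connects_of_joinedIn (hK.joinedIn p ⟨u, rfl⟩ e he) hpy (by linarith)
      hey).mono ?_)
    rintro q ⟨⟨v, rfl⟩, hq⟩
    have hq' := (hγ v).1
    rw [ballUnion_union] at hq'
    exact hq'.resolve_left (hcon _ ⟨v, rfl⟩ hq)
  obtain ⟨_, ⟨v, rfl⟩, hqy, hq⟩ := hnear
  obtain ⟨c, r, hcs, hr⟩ := mem_ballUnion.1 hq
  have hqx : dist (γ v) x ≤ α := (hγ v).2
  have hr₀r : r₀ ≤ r := by
    by_contra hlt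
    push Not at hlt
    refine Set.disjoint_left.1 hs hcs ⟨Metric.mem_closedBall.2 ?_, hlt⟩
    have := dist_triangle_left c x (γ v)
    simp only
    linarith
  -- `p` is within `η / 2 + η` of a point of `B(c, r)`, which is less than `2 * η ≤ δ * r₀ ≤ δ * r`.
  refine mem_ballUnion.2 ⟨c, (1 + δ) * r, ⟨(c, r), hcs, rfl⟩, ?_⟩
  have h1 := dist_triangle_right p (γ v) (x + z)
  have h2 := dist_triangle p (γ v) c
  have h3 : δ * r₀ ≤ δ * r := by gcongr
  linarith

/-- A similarity of ratio `(1 + δ)⁻¹` sending `x` to `0` restores the radii and multiplies the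
density of the centres by `(1 + δ) ^ d`. The resulting intensity is at most that of `ξ'`, and
crossing is an increasing event. -/
lemma Drives.measure_crosses_enlarge_le {Ω Ω' : Type*} [MeasurableSpace Ω] [MeasurableSpace Ω']
    {P : Measure Ω} {P' : Measure Ω'} [IsProbabilityMeasure P] [IsProbabilityMeasure P']
    {ξ : Ω → Set (EuclideanSpace ℝ (Fin d) × ℝ)} {ξ' : Ω' → Set (EuclideanSpace ℝ (Fin d) × ℝ)}
    {μ : Measure ℝ} [IsFiniteMeasure μ] {lam lam' : ℝ≥0} (h : Drives P ξ (lam • μ))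
    (h' : Drives P' ξ' (lam' • μ)) {δ : ℝ} (hδ : 0 < δ) (hlam : (1 + δ) ^ d * lam ≤ lam')
    (x : EuclideanSpace ℝ (Fin d)) (α : ℝ) :
    P {ω | Crosses x α ((fun b => (b.1, (1 + δ) * b.2)) '' ξ ω)} ≤
      P' {ω | Crosses 0 ((1 + δ)⁻¹ * α) (ξ' ω)} := by
  have hk : 0 < (1 + δ)⁻¹ := by positivity
  set g : EuclideanSpace ℝ (Fin d) × ℝ → EuclideanSpace ℝ (Fin d) × ℝ := fun b =>
    ((1 + δ)⁻¹ • (b.1 - x), b.2) with hg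
  have hgm : Measurable g := by fun_prop
  have hsub : {ω | Crosses x α ((fun b => (b.1, (1 + δ) * b.2)) '' ξ ω)} ⊆
      {ω | Crosses 0 ((1 + δ)⁻¹ * α) (g '' ξ ω)} := by
    refine Set.ofPred_subset.2 fun ω hω => ?_
    have := hω.image_similarity (φ := fun p => (1 + δ)⁻¹ • (p - x)) hk fun p q => by
      rw [dist_smul₀, Real.norm_of_nonneg hk.le, dist_sub_right]
    rw [Set.image_image] at this
    have hne : (1 + δ) ≠ 0 := by positivity
    simpa [hg, inv_mul_cancel_left₀ hne] using this
  have hν : ∀ A, MeasurableSet A →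
      ((volume : Measure (EuclideanSpace ℝ (Fin d))).prod (lam • μ)) (g ⁻¹' A) ≤
        ((volume : Measure (EuclideanSpace ℝ (Fin d))).prod (lam' • μ)) A := by
    intro A hA
    rw [Measure.prod_apply_symm (hgm hA), Measure.prod_apply_symm hA, lintegral_smul_measure,
      lintegral_smul_measure]
    have hsl : ∀ r, volume ((fun c => (c, r)) ⁻¹' (g ⁻¹' A)) =
        ENNReal.ofReal ((1 + δ) ^ d) * volume ((fun c => (c, r)) ⁻¹' A) := by
      intro r
      have e1 : (fun c => (c, r)) ⁻¹' (g ⁻¹' A) = (fun c => c - x) ⁻¹'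
          ((fun c => (1 + δ)⁻¹ • c) ⁻¹' ((fun c => (c, r)) ⁻¹' A)) := rfl
      simp_rw [sub_eq_add_neg] at e1
      rw [e1, measure_preimage_add_right, Measure.addHaar_preimage_smul _ hk.ne',
        finrank_euclideanSpace_fin, inv_pow, inv_inv, abs_of_pos (by positivity)]
    simp_rw [hsl]
    rw [lintegral_const_mul _ (measurable_measure_prodMk_right hA)]
    simp only [ENNReal.smul_def, smul_eq_mul]
    rw [← mul_assoc]
    gcongr
    rw [← ENNReal.ofReal_coe_nnreal, ← ENNReal.ofReal_coe_nnreal,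
      ← ENNReal.ofReal_mul (by positivity), mul_comm]
    exact ENNReal.ofReal_le_ofReal hlam
  refine (measure_mono hsub).trans ?_
  obtain ⟨𝓕, h𝓕⟩ := exists_connects_iff_hitSome
    (Metric.sphere (0 : EuclideanSpace ℝ (Fin d)) ((1 + δ)⁻¹ * α / 2))
    (Metric.sphere 0 ((1 + δ)⁻¹ * α))
  simp_rw [Crosses, h𝓕]
  refine (h.isCompletelyRandom.image hgm).measure_hitSome_mono h'.isCompletelyRandom ?_
    measurableSet_containing 𝓕
  intro A hA
  rw [avoid_image]
  exact h.measure_avoid_anti h' (hgm hA) hA (hν A hA)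

end FirstScale

/-! ### Subcritical regime: induction on the number of scales -/

section Subcritical

universe u

variable {d : ℕ}

/-- The mass of `]-∞, r₀[` tends to that of `]-∞, 0]`, which is zero. Translation invariance makes
`r₀` independent of `x`. -/
lemma exists_small_radius {μ : Measure ℝ} [IsFiniteMeasure μ] (hμ : μ (Set.Iic 0) = 0)
    (lam : ℝ≥0) {L : ℝ} (hL : 0 ≤ L) {ε : ℝ≥0∞} (hε : 0 < ε) :
    ∃ r₀ : ℝ, 0 < r₀ ∧ r₀ ≤ 1 ∧ ∀ x : EuclideanSpace ℝ (Fin d),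
      ((volume : Measure (EuclideanSpace ℝ (Fin d))).prod (lam • μ))
        (Metric.closedBall x (L + 1) ×ˢ Set.Iio r₀) ≤ ε := by
  set V := ENNReal.ofReal ((L + 1) ^ d) *
    volume (Metric.ball (0 : EuclideanSpace ℝ (Fin d)) 1) with hV
  have hVtop : V ≠ ∞ := ENNReal.mul_ne_top ENNReal.ofReal_ne_top measure_ball_lt_top.ne
  have hlim : Tendsto (fun n : ℕ => (lam • μ) (Set.Iio (1 / ((n : ℝ) + 1)))) atTop (𝓝 0) := by
    have hinter : (⋂ n : ℕ, Set.Iio (1 / ((n : ℝ) + 1))) = Set.Iic 0 := by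
      ext r
      simp only [Set.mem_iInter, Set.mem_Iio, Set.mem_Iic]
      refine ⟨fun h => ?_, fun h n => h.trans_lt (by positivity)⟩
      exact ge_of_tendsto' tendsto_one_div_add_atTop_nhds_zero_nat fun n => (h n).le
    have h0 : (lam • μ) (⋂ n : ℕ, Set.Iio (1 / ((n : ℝ) + 1))) = 0 := by
      rw [hinter, Measure.smul_apply, hμ, smul_zero]
    rw [← h0]
    refine tendsto_measure_iInter_atTop (fun n => measurableSet_Iio.nullMeasurableSet)
      (fun m n hmn => Set.Iio_subset_Iio ?_) ⟨0, measure_ne_top _ _⟩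
    exact Nat.one_div_le_one_div hmn
  have hlim' := ENNReal.Tendsto.const_mul (a := V) hlim (Or.inr hVtop)
  rw [mul_zero] at hlim'
  obtain ⟨n, hn⟩ := (ENNReal.tendsto_nhds_zero.1 hlim' ε hε).exists
  refine ⟨1 / ((n : ℝ) + 1), by positivity, ?_, fun x => ?_⟩
  · rw [div_le_one (by positivity)]; simp
  · rwa [Measure.prod_prod, volume_closedBall_eq x (by linarith)]

/-- Adding a smaller scale to a subcritical Boolean model does not increase crossing probabilities
much, provided that the smaller scale rarely contains long crossings. -/
lemma DrivesCopies.measure_crosses_scales_succ_le {Ω Ω' : Type*} [MeasurableSpace Ω]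
    [MeasurableSpace Ω'] {P : Measure Ω} {P' : Measure Ω'} [IsProbabilityMeasure P]
    [IsProbabilityMeasure P'] {ξ : ℕ → Ω → Set (EuclideanSpace ℝ (Fin d) × ℝ)}
    {ξ' : Ω' → Set (EuclideanSpace ℝ (Fin d) × ℝ)} {μ : Measure ℝ} [IsFiniteMeasure μ]
    {lam lam' : ℝ≥0} (h : DrivesCopies P ξ (lam • μ)) (h' : Drives P' ξ' (lam' • μ))
    {α η δ r₀ L ρ : ℝ} (hρ : 0 < ρ) (hη : 0 < η) (hδ : 0 < δ)
    (hlam : (1 + δ) ^ d * lam ≤ lam') (hηδ : 2 * η ≤ δ * r₀) (hr₀ : r₀ ≤ 1) (hηα : 4 * η ≤ α)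
    (hαL : α ≤ L) {Z : Finset (EuclideanSpace ℝ (Fin d))}
    (hnet : ∀ p, dist p (0 : EuclideanSpace ℝ (Fin d)) ≤ L → ∃ z ∈ Z, dist p z ≤ η / 2)
    {N : ℕ} {ε : ℝ≥0∞}
    (hε : ∀ y, P {ω | Crosses y (ρ * η) (scales ρ (fun n => ξ (n + 1)) N ω)} ≤ ε)
    (x : EuclideanSpace ℝ (Fin d)) :
    P {ω | Crosses x α (scales ρ ξ (N + 1) ω)} ≤ Z.card * ε +
      ((volume : Measure (EuclideanSpace ℝ (Fin d))).prod (lam • μ))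
        (Metric.closedBall x (L + 1) ×ˢ Set.Iio r₀) +
      crossingProb P' (fun ω => ballUnion (ξ' ω)) ((1 + δ)⁻¹ * α) := by
  set S : Set (EuclideanSpace ℝ (Fin d) × ℝ) := Metric.closedBall x (L + 1) ×ˢ Set.Iio r₀
  have hS : MeasurableSet S := measurableSet_closedBall.prod measurableSet_Iio
  have hsub : {ω | Crosses x α (scales ρ ξ (N + 1) ω)} ⊆
      ((⋃ z ∈ Z, {ω | Crosses (ρ • (x + z)) (ρ * η) (scales ρ (fun n => ξ (n + 1)) N ω)}) ∪
        (avoid (ξ 0) S)ᶜ) ∪ {ω | Crosses x α ((fun b => (b.1, (1 + δ) * b.2)) '' ξ 0 ω)} := by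
    refine Set.ofPred_subset.2 fun ω hω => ?_
    rw [scales_succ] at hω
    by_contra hcon
    simp only [Set.mem_union, not_or, Set.mem_iUnion, not_exists, Set.mem_compl_iff,
      not_not, Set.mem_ofPred_eq] at hcon
    obtain ⟨⟨h1, h2⟩, h3⟩ := hcon
    exact h3 (hω.enlarge hη hδ hηδ hr₀ hηα hαL hnet (fun z hz hc => h1 z hz (hc.of_shrink hρ)) h2)
  refine (measure_mono hsub).trans ((measure_union_le _ _).trans (add_le_add
    ((measure_union_le _ _).trans (add_le_add ?_ ?_)) ?_))
  · refine (measure_biUnion_finset_le _ _).trans ?_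
    refine (Finset.sum_le_card_nsmul _ _ ε fun z _ => hε _).trans ?_
    rw [nsmul_eq_mul]
  · exact (h.drives 0).measure_compl_avoid_le hS
  · exact (h.drives 0).measure_crosses_enlarge_le h' hδ hlam x α

lemma exists_enlargement {lam lam' : ℝ≥0} (h : lam < lam') :
    ∃ δ : ℝ, 0 < δ ∧ (1 + δ) ^ d * lam ≤ lam' := by
  have hc : Tendsto (fun δ : ℝ => (1 + δ) ^ d * (lam : ℝ)) (𝓝[>] 0) (𝓝 ((1 + 0) ^ d * lam)) :=
    tendsto_nhdsWithin_of_tendsto_nhds (Continuous.tendsto (by fun_prop) 0)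
  have hlt : (1 + 0 : ℝ) ^ d * lam < lam' := by simpa using h
  obtain ⟨δ, h1, h2⟩ := ((hc.eventually_lt_const hlt).and self_mem_nhdsWithin).exists
  exact ⟨δ, h2, h1.le⟩

/-- Below the critical parameter and for a large scale factor, the probability of a crossing at
scale `α` goes to `0` uniformly in the number of scales. -/
theorem exists_forall_measure_crosses_scales_le {μ : Measure ℝ} [IsFiniteMeasure μ]
    (hμ : μ (Set.Iic 0) = 0) (hlog : logMoment d μ < ∞) {lam : ℝ≥0}
    (hlam : (lam : ℝ≥0∞) < lambdaHat d μ) :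
    ∃ ρ₀ : ℝ, 1 < ρ₀ ∧ ∀ θ : ℝ≥0∞, 0 < θ → ∃ A : ℝ, ∀ ρ : ℝ, ρ₀ ≤ ρ →
      ∀ (Ω : Type u) [MeasurableSpace Ω] (P : Measure Ω) [IsProbabilityMeasure P]
        (ξ : ℕ → Ω → Set (EuclideanSpace ℝ (Fin d) × ℝ)), DrivesCopies P ξ (lam • μ) →
        ∀ (N : ℕ) (x : EuclideanSpace ℝ (Fin d)) (α : ℝ), A ≤ α →
          P {ω | Crosses x α (scales ρ ξ N ω)} ≤ θ := by
  obtain ⟨lam', hlam'⟩ := lt_iSup_iff.1 hlam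
  obtain ⟨⟨-, Ω', _, P', _, ξ', hξ', hcross⟩, hlt⟩ := lt_iSup_iff.1 hlam'
  obtain ⟨δ, hδ, hδlam⟩ := exists_enlargement (d := d) (ENNReal.coe_lt_coe.1 hlt)
  obtain ⟨Z, hZ, hZnet⟩ := exists_finset_net (0 : EuclideanSpace ℝ (Fin d)) 10
    (m := 1 / 2) (by norm_num)
  set C : ℝ≥0∞ := (Z.card : ℝ≥0∞) ^ 2 with hC
  obtain ⟨ε, hε0, hεC⟩ := ENNReal.exists_nnreal_pos_mul_lt (a := C) (b := 2⁻¹)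
    (by simp [hC]) (by simp)
  have hCε : C * ε ≤ 2⁻¹ := by rw [mul_comm]; exact hεC.le
  have hε0' : (ε : ℝ≥0∞) ≠ 0 := by exact_mod_cast hε0.ne'
  have hε3 : (0 : ℝ≥0∞) < ε / 3 := ENNReal.div_pos hε0' (by simp)
  have hT := tendsto_tailBound hlog lam
  obtain ⟨a₁, ha₁⟩ := eventually_atTop.1
    (ENNReal.tendsto_nhds_zero.1 hT (ε / 2) (ENNReal.div_pos hε0' (by simp)))
  obtain ⟨a₂, ha₂⟩ := eventually_atTop.1 (ENNReal.tendsto_nhds_zero.1 hcross (ε / 3) hε3)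
  -- The three terms serve the counting of scales, the smallness of `tailBound`, and that of the
  -- crossing probability of `ξ'` at scale `(1 + δ)⁻¹ * α`.
  set α₀ := max (Real.exp 1) (max a₁ ((1 + δ) * a₂)) with hα₀def
  have hα₀e : Real.exp 1 ≤ α₀ := le_max_left _ _
  have hα₀1 : a₁ ≤ α₀ := (le_max_left _ _).trans (le_max_right _ _)
  have hα₀2 : (1 + δ) * a₂ ≤ α₀ := (le_max_right _ _).trans (le_max_right _ _)
  have hα₀ : 0 < α₀ := (Real.exp_pos 1).trans_le hα₀e
  obtain ⟨r₀, hr₀, hr₀1, hsmall⟩ := exists_small_radius (d := d) hμ lam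
    (L := 10 * α₀) (by positivity) hε3
  set η := min (δ * r₀ / 2) (α₀ / 4) with hηdef
  have hη : 0 < η := lt_min (by positivity) (by positivity)
  have hη1 : η ≤ δ * r₀ / 2 := min_le_left _ _
  have hη2 : η ≤ α₀ / 4 := min_le_right _ _
  obtain ⟨Y, -, hYnet⟩ := exists_finset_net (0 : EuclideanSpace ℝ (Fin d)) (10 * α₀)
    (m := η / 2) (by positivity)
  obtain ⟨κ, hκ0, hκ⟩ := ENNReal.exists_nnreal_pos_mul_lt (a := (Y.card : ℝ≥0∞)) (b := ε / 3)
    (by simp) hε3.ne'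
  obtain ⟨A, hA⟩ := exists_decay hα₀ hCε ENNReal.coe_ne_top hT
    (η := κ) (by exact_mod_cast hκ0)
  -- This choice gives `ρ * η ≥ A` for `ρ ≥ ρ₀`. It is not circular: the decay threshold `A` is
  -- independent of `ρ` and of the number of scales.
  set ρ₀ := max (Real.exp 1) (A / η) with hρ₀
  have key : ∀ ρ : ℝ, ρ₀ ≤ ρ →
      ∀ (Ω : Type u) [MeasurableSpace Ω] (P : Measure Ω) [IsProbabilityMeasure P]
        (ξ : ℕ → Ω → Set (EuclideanSpace ℝ (Fin d) × ℝ)), DrivesCopies P ξ (lam • μ) → ∀ N,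
        (∀ α, α₀ ≤ α → (⨆ x, P {ω | Crosses x (10 * α) (scales ρ ξ N ω)}) ≤
          C * (⨆ x, P {ω | Crosses x α (scales ρ ξ N ω)}) ^ 2 + tailBound d μ lam α) ∧
        ∀ α, α₀ ≤ α → (⨆ x, P {ω | Crosses x α (scales ρ ξ N ω)}) ≤ ε := by
    intro ρ hρ Ω _ P _ ξ hξ N
    have hρe : Real.exp 1 ≤ ρ := (le_max_left _ _).trans hρ
    have hρ0 : 0 < ρ := (Real.exp_pos 1).trans_le hρe
    -- Stated for every sequence of copies, since the induction applies it to the shifted sequence.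
    have hrec : ∀ (ξ : ℕ → Ω → Set (EuclideanSpace ℝ (Fin d) × ℝ)),
        DrivesCopies P ξ (lam • μ) → ∀ N α, α₀ ≤ α →
        (⨆ x, P {ω | Crosses x (10 * α) (scales ρ ξ N ω)}) ≤
          C * (⨆ x, P {ω | Crosses x α (scales ρ ξ N ω)}) ^ 2 + tailBound d μ lam α := by
      intro ξ hξ N α hα
      refine iSup_le fun x => ?_
      refine ((hξ.isCompletelyRandom_scales ρ N).measure_crosses_le hZ hZnet (hα₀.trans_le hα)
        (fun y => le_iSup (fun y => P {ω | Crosses y α (scales ρ ξ N ω)}) y) x).trans ?_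
      gcongr
      exact (hξ.measure_compl_avoid_scales_le ρ N (measurableSet_bigBalls x α)).trans
        (sum_prod_bigBalls_le lam hρe (hα₀e.trans hα) x N)
    refine ⟨hrec ξ hξ N, ?_⟩
    induction N generalizing ξ with
    | zero =>
      intro α _
      refine iSup_le fun x => ?_
      have : {ω | Crosses x α (scales ρ ξ 0 ω)} = ∅ := by
        refine Set.eq_empty_of_forall_notMem fun ω hω => ?_
        obtain ⟨a, -, b, -, hab⟩ := hω
        simpa [scales, ballUnion] using hab.source_mem
      rw [this, measure_empty]; exact zero_le
    | succ N ih =>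
      refine le_of_recurrence hα₀ (hrec ξ hξ (N + 1)) hCε
        (fun α hα => ha₁ α (hα₀1.trans hα)) fun α hα hα' => iSup_le fun x => ?_
      have hdec : ∀ y, P {ω | Crosses y (ρ * η) (scales ρ (fun n => ξ (n + 1)) N ω)} ≤ κ := by
        intro y
        refine (le_iSup (fun y => P {ω | Crosses y (ρ * η)
          (scales ρ (fun n => ξ (n + 1)) N ω)}) y).trans ?_
        refine hA (fun α => ⨆ y, P {ω | Crosses y α (scales ρ (fun n => ξ (n + 1)) N ω)})
          (hrec _ hξ.shift N) (ih _ hξ.shift) _ ?_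
        rw [← div_le_iff₀ hη]
        exact (le_max_right _ _).trans hρ
      refine (hξ.measure_crosses_scales_succ_le hξ' hρ0 hη hδ hδlam (by linarith) hr₀1
        (by linarith) hα' hYnet hdec x).trans ?_
      -- One third each for a small-scale crossing near some point of the net, for a first-scale
      -- ball of radius below `r₀`, and for a crossing by the enlarged balls.
      rw [← ENNReal.add_thirds (ε : ℝ≥0∞)]
      gcongr
      · rw [mul_comm]; exact hκ.le
      · exact hsmall x
      · refine ha₂ _ ?_
        rw [le_inv_mul_iff₀ (by positivity)]
        exact hα₀2.trans hα
  refine ⟨ρ₀, (Real.one_lt_exp_iff.2 one_pos).trans_le (le_max_left _ _), fun θ hθ => ?_⟩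
  obtain ⟨B, hB⟩ := exists_decay hα₀ hCε ENNReal.coe_ne_top hT hθ
  refine ⟨B, fun ρ hρ Ω _ P _ ξ hξ N x α hα => ?_⟩
  obtain ⟨h1, h2⟩ := key ρ hρ Ω P ξ hξ N
  exact (le_iSup (fun y => P {ω | Crosses y α (scales ρ ξ N ω)}) x).trans
    (hB (fun α => ⨆ y, P {ω | Crosses y α (scales ρ ξ N ω)}) h1 h2 α hα)

/-- A crossing uses finitely many scales, so the event is contained in an increasing union, to which
continuity from below applies. -/
lemma crossingProb_multiscale_le {Ω : Type*} [MeasurableSpace Ω] {P : Measure Ω} {ρ : ℝ}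
    (hρ : 0 < ρ) {ξ : ℕ → Ω → Set (EuclideanSpace ℝ (Fin d) × ℝ)} {r : ℝ} {θ : ℝ≥0∞}
    (h : ∀ N, P {ω | Crosses 0 r (scales ρ ξ N ω)} ≤ θ) :
    crossingProb P (multiscale ρ ξ) r ≤ θ := by
  have hsub : {ω | Connects (multiscale ρ ξ ω) (Metric.sphere 0 (r / 2)) (Metric.sphere 0 r)} ⊆
      ⋃ N, {ω | Crosses 0 r (scales ρ ξ N ω)} := by
    refine Set.ofPred_subset.2 fun ω hω => ?_
    rw [multiscale_eq hρ] at hω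
    obtain ⟨N, hN⟩ := exists_connects_ballUnion (scales_mono ρ ξ ω) hω
    exact Set.mem_iUnion.2 ⟨N, hN⟩
  refine (measure_mono hsub).trans ?_
  have hmono : Monotone fun N => {ω | Crosses 0 r (scales ρ ξ N ω)} :=
    fun M N hMN => Set.ofPred_subset.2 fun ω hω => Crosses.mono hω (scales_mono ρ ξ ω hMN)
  rw [hmono.measure_iUnion]
  exact iSup_le h

/-- An unbounded component of the origin crosses every shell centred at the origin. -/
lemma connects_of_not_isBounded {U : Set (EuclideanSpace ℝ (Fin d))} (hU : IsOpen U)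
    (h : ¬ Bornology.IsBounded (connectedComponentIn U 0)) {r : ℝ} (hr : 0 ≤ r) :
    Connects U (Metric.sphere 0 (r / 2)) (Metric.sphere 0 r) := by
  by_cases h0 : (0 : EuclideanSpace ℝ (Fin d)) ∈ U
  · have hpc : IsPathConnected (connectedComponentIn U 0) :=
      (hU.connectedComponentIn.isConnected_iff_isPathConnected).1
        (isConnected_connectedComponentIn_iff.2 h0)
    have hb : ∃ b ∈ connectedComponentIn U 0, r ≤ dist b 0 := by
      by_contra hcon
      push Not at hcon
      exact h (Metric.isBounded_closedBall.subset
        (fun b hb => Metric.mem_closedBall.2 (hcon b hb).le))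
    obtain ⟨b, hb, hbr⟩ := hb
    have hj := (hpc.joinedIn 0 (mem_connectedComponentIn h0) b hb).mono
      (connectedComponentIn_subset U 0)
    exact (connects_of_joinedIn hj (by simpa using by positivity) (by linarith) hbr).mono
      Set.inter_subset_left
  · exact absurd (by rw [connectedComponentIn_eq_empty h0]; exact Bornology.isBounded_empty) h

/-- The percolation event is contained in the crossing event of every radius `r ≥ 0`. -/
lemma not_percolates_of_tendsto_crossingProb {Ω : Type*} [MeasurableSpace Ω] {P : Measure Ω}
    {S : Ω → Set (EuclideanSpace ℝ (Fin d))} (hS : ∀ ω, IsOpen (S ω))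
    (h : Tendsto (crossingProb P S) atTop (𝓝 0)) : ¬ Percolates P S := by
  refine not_lt.2 (ge_of_tendsto h ?_)
  filter_upwards [eventually_ge_atTop 0] with r hr
  exact measure_mono (Set.ofPred_subset.2 fun ω hω => connects_of_not_isBounded (hS ω) hω hr)

end Subcritical

end BooleanModel

theorem theorem2 (d : ℕ) (hd : 2 ≤ d) (μ : Measure ℝ) [IsFiniteMeasure μ]
    (hμ_pos : μ (Set.Iic 0) = 0) (hμ_mass : μ ≠ 0) :
    (BooleanModel.logMoment d μ < ∞ →
      ∀ lam : ℝ≥0, (lam : ℝ≥0∞) < BooleanModel.lambdaHat d μ →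
        ∃ ρ₀ : ℝ, 1 < ρ₀ ∧ ∀ ρ : ℝ, ρ₀ ≤ ρ →
          ∀ (Ω : Type*) [MeasurableSpace Ω] (P : Measure Ω) [IsProbabilityMeasure P]
            (ξ : ℕ → Ω → Set (EuclideanSpace ℝ (Fin d) × ℝ)),
            BooleanModel.DrivesCopies P ξ (lam • μ) →
              Tendsto (BooleanModel.crossingProb P (BooleanModel.multiscale ρ ξ)) atTop (𝓝 0) ∧
              ¬ BooleanModel.Percolates P (BooleanModel.multiscale ρ ξ)) ∧
    (BooleanModel.logMoment d μ = ∞ →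
      ∀ lam : ℝ≥0, 0 < lam → ∀ ρ : ℝ, 1 < ρ →
        ∀ (Ω : Type*) [MeasurableSpace Ω] (P : Measure Ω) [IsProbabilityMeasure P]
          (ξ : ℕ → Ω → Set (EuclideanSpace ℝ (Fin d) × ℝ)),
          BooleanModel.DrivesCopies P ξ (lam • μ) →
            BooleanModel.Percolates P (BooleanModel.multiscale ρ ξ)) := by
  refine ⟨fun hlog lam hlam => ?_, fun hlog lam hlam ρ hρ Ω _ P _ ξ hξ =>
    hξ.percolates (by omega) hlog hlam hρ⟩
  obtain ⟨ρ₀, hρ₀, H⟩ :=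
    BooleanModel.exists_forall_measure_crosses_scales_le hμ_pos hlog hlam
  refine ⟨ρ₀, hρ₀, fun ρ hρ Ω _ P _ ξ hξ => ?_⟩
  have hρ0 : 0 < ρ := by linarith
  have hlim : Tendsto (BooleanModel.crossingProb P (BooleanModel.multiscale ρ ξ)) atTop (𝓝 0) := by
    refine ENNReal.tendsto_nhds_zero.2 fun θ hθ => ?_
    obtain ⟨A, hA⟩ := H θ hθ
    filter_upwards [eventually_ge_atTop A] with r hr
    exact BooleanModel.crossingProb_multiscale_le hρ0 fun N => hA ρ hρ Ω P ξ hξ N 0 r hr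
  refine ⟨hlim, BooleanModel.not_percolates_of_tendsto_crossingProb (fun ω => ?_) hlim⟩
  rw [BooleanModel.multiscale_eq hρ0]
  exact BooleanModel.isOpen_ballUnion _
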